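/- Let $H$ be a complex Hilbert space, $\mathcal A\subseteq B(H)$ a von Neumann algebra containing $\mathbb 1_H$, and $T:\mathcal A\to\mathcal A$ a Markov operator, i.e. a normal completely positive linear map with $T(\mathbb 1)=\mathbb 1$. A normal state on $\mathcal A$ is a functional $x\mapsto \mathrm{tr}(\rho x)$ with $\rho\ge 0$, $\mathrm{tr}(\rho)=1$; it is stationary if $\varphi\circ T=\varphi$; a unital positive map $S$ on $\mathcal A$ is normal if $\varphi\circ S$ is a normal state for every normal state $\varphi$. Put $\mathrm{Fix}\,T=\{x\in\mathcal A: T(x)=x\}$. An orthogonal projection $p\in\mathcal A$ is positive recurrent if $p\le\bigvee_i \mathrm{supp}\,\varphi_i$ for some family $(\varphi_i)$ of stationary normal states, and $p_R$ denotes the supremum of all positive recurrent projections. An ergodic projection for $T$ is a (not necessarily normal) linear map $P:\mathcal A\to\mathcal A$ in the pointwise weak* closure of the convex hull of $\{T^n:n\ge 1\}$ with $TP=PT=P=P^2$; its Choi–Effros product on $\mathrm{Fix}\,T$ is $a\diamond b=P(ab)$. $T$ is weak* mean ergodic if it has a normal ergodic projection. Then the following are equivalent: (i) $T$ is weak* mean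 ergodic; (ii) there is an ergodic projection $P$ for $T$ with $P(p_R)=\mathbb 1$; (iii) the map $\mathrm{Fix}\,T\ni x\mapsto p_R\,x\,p_R\in p_R(\mathrm{Fix}\,T)p_R$ is injective (hence bijective); (iv) there is an ergodic projection $P$ for $T$ such that $p_R(\mathrm{Fix}\,T)p_R$ is a *-subalgebra of $\mathcal A$ and $J_T:p_R(\mathrm{Fix}\,T)p_R\to(\mathrm{Fix}\,T,\diamond)$, $x\mapsto P(x)$, is a *-isomorphism. Moreover, if $T$ is weak* mean ergodic and $P$ is a normal ergodic projection for $T$, then $P$ is the only ergodic projection for $T$, and $J_T: x\mapsto P(x)$ is a *-isomorphism from $p_R(\mathrm{Fix}\,T)p_R$ onto $(\mathrm{Fix}\,T,\diamond)$ (the abstract Poisson integral): for every $x\in p_R(\mathrm{Fix}\,T)p_R$ one has $P(x)=x+(\mathbb 1-p_R)P(x)(\mathbb 1-p_R)$, and $P(x)$ is the unique $y\in\mathrm{Fix}\,T$ with $p_R\,y\,p_R=x$. -/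

import Mathlib

open scoped CStarAlgebra InnerProductSpace

universe u

namespace VonNeumannAlgebra

variable {H : Type u} [NormedAddCommGroup H] [InnerProductSpace ℂ H] [CompleteSpace H]

/-! ### The elements of a von Neumann algebra as a C⋆-algebra -/

/-- The type of elements of a von Neumann algebra `A ⊆ B(H)`, with the operations, the norm and
the order inherited from `B(H)`. -/
abbrev Elem (A : VonNeumannAlgebra H) : Type u := ↥A.toStarSubalgebra

instance isClosed_toStarSubalgebra (A : VonNeumannAlgebra H) :
    IsClosed (A.toStarSubalgebra : Set (H →L[ℂ] H)) := by
  have h : (A.toStarSubalgebra : Set (H →L[ℂ] H)) =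
      Set.centralizer (Set.centralizer (A.toStarSubalgebra : Set (H →L[ℂ] H))) :=
    A.centralizer_centralizer'.symm
  rw [h]
  exact Set.isClosed_centralizer _

/-- `0 ≤ x` in `A` (that is, `x` is a positive operator) if and only if `x = s⋆ s` with `s ∈ A`. -/
instance instStarOrderedRingElem (A : VonNeumannAlgebra H) : StarOrderedRing A.Elem := by
  refine StarOrderedRing.of_nonneg_iff' (fun {x y} h z => ?_) (fun x => ⟨fun hx => ?_, ?_⟩)
  · have h' : (x : H →L[ℂ] H) ≤ y := h
    have : (z : H →L[ℂ] H) + x ≤ z + y := by gcongr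
    exact this
  · have hx' : (0 : H →L[ℂ] H) ≤ x := hx
    have hmem : CFC.sqrt (x : H →L[ℂ] H) ∈ A.toStarSubalgebra := by
      have : CFC.sqrt (x : H →L[ℂ] H) ∈
          Set.centralizer (Set.centralizer (A : Set (H →L[ℂ] H))) := by
        rw [Set.mem_centralizer_iff]
        intro y hy
        have hc : Commute (x : H →L[ℂ] H) y := (Set.mem_centralizer_iff.1 hy) _ x.2
        exact (Commute.cfcₙ_nnreal hc NNReal.sqrt).symm.eq
      rw [A.centralizer_centralizer] at this
      exact this
    refine ⟨⟨_, hmem⟩, Subtype.ext ?_⟩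
    have h1 : star (CFC.sqrt (x : H →L[ℂ] H)) = CFC.sqrt (x : H →L[ℂ] H) :=
      (IsSelfAdjoint.of_nonneg (CFC.sqrt_nonneg _)).star_eq
    change (x : H →L[ℂ] H) = star (CFC.sqrt (x : H →L[ℂ] H)) * CFC.sqrt (x : H →L[ℂ] H)
    rw [h1, CFC.sqrt_mul_sqrt_self _ hx']
  · rintro ⟨s, rfl⟩
    have : (0 : H →L[ℂ] H) ≤ star (s : H →L[ℂ] H) * s := star_mul_self_nonneg _
    exact this

/-! ### Suprema and infima of projections -/

/-- The closed linear span of the ranges of the operators in `S`. -/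
noncomputable def rangeSpan {A : VonNeumannAlgebra H} (S : Set A.Elem) : Submodule ℂ H :=
  (⨆ p ∈ S, LinearMap.range ((p : H →L[ℂ] H) : H →ₗ[ℂ] H)).topologicalClosure

instance rangeSpan_completeSpace {A : VonNeumannAlgebra H} (S : Set A.Elem) :
    CompleteSpace (rangeSpan S) :=
  (Submodule.isClosed_topologicalClosure _).completeSpace_coe

theorem starProjection_rangeSpan_mem {A : VonNeumannAlgebra H} (S : Set A.Elem) :
    (rangeSpan S).starProjection ∈ A.toStarSubalgebra := by
  have key : (rangeSpan S).starProjection ∈ A := by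
    rw [IsStarProjection.mem_iff isStarProjection_starProjection]
    intro y hy
    have hr : ((rangeSpan S).starProjection).range = rangeSpan S :=
      Submodule.range_starProjection _
    rw [hr]
    refine Submodule.topologicalClosure_mem_invtSubmodule ?_
    rw [Module.End.mem_invtSubmodule]
    refine iSup₂_le fun p hp => ?_
    rintro _ ⟨v, rfl⟩
    rw [Submodule.mem_comap]
    have hc : (p : H →L[ℂ] H) * y = y * p := (mem_commutant_iff.1 hy) _ p.2
    refine (le_iSup₂_of_le p hp le_rfl :
      LinearMap.range ((p : H →L[ℂ] H) : H →ₗ[ℂ] H) ≤ _) ⟨y v, ?_⟩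
    exact congrArg (fun z : H →L[ℂ] H => z v) hc
  exact key

/-- The supremum of a set `S` of projections of `A`: the projection onto the closed linear span
of their ranges. -/
noncomputable def projSup {A : VonNeumannAlgebra H} (S : Set A.Elem) : A.Elem :=
  ⟨(rangeSpan S).starProjection, starProjection_rangeSpan_mem S⟩

/-- The infimum of a set of projections of `A`, as the complement of the supremum of the
complements. -/
noncomputable def projInf {A : VonNeumannAlgebra H} (S : Set A.Elem) : A.Elem :=
  1 - projSup ((fun p => 1 - p) '' S)

theorem isStarProjection_projSup {A : VonNeumannAlgebra H} (S : Set A.Elem) :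
    IsStarProjection (projSup S) := by
  have h : IsStarProjection (rangeSpan S).starProjection := isStarProjection_starProjection
  exact ⟨Subtype.ext h.isIdempotentElem, Subtype.ext h.isSelfAdjoint⟩

/-- `projSup S` is the smallest projection of `A` above all projections in `S`. -/
theorem isLeast_projSup {A : VonNeumannAlgebra H} {S : Set A.Elem}
    (hS : ∀ p ∈ S, IsStarProjection p) :
    IsLeast {q : A.Elem | IsStarProjection q ∧ ∀ p ∈ S, p ≤ q} (projSup S) := by
  have coe : ∀ {p : A.Elem}, IsStarProjection p →
      ∃ U : Submodule ℂ H, ∃ _ : U.HasOrthogonalProjection,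
        (p : H →L[ℂ] H) = U.starProjection ∧
          LinearMap.range ((p : H →L[ℂ] H) : H →ₗ[ℂ] H) = U := by
    intro p hp
    have hp' : IsStarProjection (p : H →L[ℂ] H) :=
      ⟨congrArg Subtype.val hp.isIdempotentElem, congrArg Subtype.val hp.isSelfAdjoint⟩
    obtain ⟨U, hU, h⟩ := isStarProjection_iff_eq_starProjection.1 hp'
    refine ⟨U, hU, h, ?_⟩
    rw [h]
    exact Submodule.range_starProjection U
  refine ⟨⟨isStarProjection_projSup S, fun p hp => ?_⟩, fun q hq => ?_⟩
  · obtain ⟨U, hU, h, hr⟩ := coe (hS p hp)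
    have : (p : H →L[ℂ] H) ≤ (rangeSpan S).starProjection := by
      rw [h, Submodule.starProjection_le_starProjection_iff, ← hr]
      exact le_trans (le_iSup₂_of_le p hp le_rfl) (Submodule.le_topologicalClosure _)
    exact this
  · obtain ⟨hq, hle⟩ := hq
    obtain ⟨V, hV, h, -⟩ := coe hq
    have : (rangeSpan S).starProjection ≤ (q : H →L[ℂ] H) := by
      rw [h, Submodule.starProjection_le_starProjection_iff]
      have hVc : IsClosed (V : Set H) := by
        rw [← Submodule.orthogonal_orthogonal V]
        exact Submodule.isClosed_orthogonal _
      refine Submodule.topologicalClosure_minimal _ (iSup₂_le fun p hp => ?_) hVc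
      obtain ⟨U, hU, h', hr⟩ := coe (hS p hp)
      have hpq : (p : H →L[ℂ] H) ≤ q := hle p hp
      rw [h, h', Submodule.starProjection_le_starProjection_iff] at hpq
      exact hr.le.trans hpq
    exact this

/-! ### Normal states and the weak⋆ topology -/

/-- `x` has trace `t`: the diagonal sum of `x` converges to `t` in every orthonormal basis. -/
def HasTrace (x : H →L[ℂ] H) (t : ℂ) : Prop :=
  ∀ (ι : Type u) (b : HilbertBasis ι ℂ H), HasSum (fun i => ⟪b i, x (b i)⟫_ℂ) t

/-- A density operator: a positive operator (necessarily of trace class) of trace `1`. -/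
structure IsDensityOperator (ρ : H →L[ℂ] H) : Prop where
  nonneg : 0 ≤ ρ
  trace_eq_one : HasTrace ρ 1

/-- Normal states on `A`: the functionals `x ↦ tr (ρ x)` for a density operator `ρ` on `H`. -/
def IsNormalState {A : VonNeumannAlgebra H} (φ : A.Elem →ₗ[ℂ] ℂ) : Prop :=
  ∃ ρ : H →L[ℂ] H, IsDensityOperator ρ ∧ ∀ x : A.Elem, HasTrace (ρ * (x : H →L[ℂ] H)) (φ x)

/-- The weak⋆ topology of `A`: the coarsest topology that makes all normal states (equivalently,
their linear span, which is the predual) continuous. -/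
noncomputable abbrev weakStarTopology (A : VonNeumannAlgebra H) : TopologicalSpace A.Elem :=
  ⨅ φ : {φ : A.Elem →ₗ[ℂ] ℂ // IsNormalState φ}, TopologicalSpace.induced φ.1 inferInstance

/-- The topology of pointwise weak⋆ convergence of maps `A → A`. -/
noncomputable abbrev pointwiseWeakStarTopology (A : VonNeumannAlgebra H) : TopologicalSpace (A.Elem → A.Elem) :=
  @Pi.topologicalSpace A.Elem (fun _ => A.Elem) (fun _ => weakStarTopology A)

/-- The support projection of `φ`: the smallest projection `p` of `A` with `φ x = φ (p x p)` for
all `x`. -/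
noncomputable def supportProjection {A : VonNeumannAlgebra H} (φ : A.Elem →ₗ[ℂ] ℂ) : A.Elem :=
  projInf {p | IsStarProjection p ∧ ∀ x, φ x = φ (p * x * p)}

/-! ### Markov operators -/

/-- A unital positive map `T` is normal if `φ ∘ T` is a normal state for every normal state `φ`. -/
def IsNormalMap {A : VonNeumannAlgebra H} (T : A.Elem →ₗ[ℂ] A.Elem) : Prop :=
  ∀ φ : A.Elem →ₗ[ℂ] ℂ, IsNormalState φ → IsNormalState (φ ∘ₗ T)

/-- Markov operators: normal completely positive unital maps. -/
structure IsMarkovOperator {A : VonNeumannAlgebra H} (T : A.Elem →ₗ[ℂ] A.Elem) : Prop where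
  completelyPositive : ∃ Φ : A.Elem →CP A.Elem, Φ.toLinearMap = T
  map_one : T 1 = 1
  normal : IsNormalMap T

/-- The fixed space of `T`. -/
noncomputable def fixedSpace {A : VonNeumannAlgebra H} (T : A.Elem →ₗ[ℂ] A.Elem) : Submodule ℂ A.Elem :=
  LinearMap.eqLocus T LinearMap.id

/-- `φ` is a stationary normal state of `T`. -/
def IsStationaryNormalState {A : VonNeumannAlgebra H} (T : A.Elem →ₗ[ℂ] A.Elem)
    (φ : A.Elem →ₗ[ℂ] ℂ) : Prop :=
  IsNormalState φ ∧ φ ∘ₗ T = φ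

/-- A projection is positive recurrent if it lies below the supremum of the supports of a family
of stationary normal states. -/
def IsPositiveRecurrent {A : VonNeumannAlgebra H} (T : A.Elem →ₗ[ℂ] A.Elem) (p : A.Elem) : Prop :=
  IsStarProjection p ∧ ∃ F : Set (A.Elem →ₗ[ℂ] ℂ),
    (∀ φ ∈ F, IsStationaryNormalState T φ) ∧ p ≤ projSup (supportProjection '' F)

/-- The maximal positive recurrent projection `p_R` of `T`. -/
noncomputable def maxPosRec {A : VonNeumannAlgebra H} (T : A.Elem →ₗ[ℂ] A.Elem) : A.Elem :=
  projSup {p | IsPositiveRecurrent T p}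

/-- Ergodic projections of `T`: the idempotent maps `P` with `T P = P T = P` in the pointwise
weak⋆ closure of the convex hull of `{T, T², T³, …}`. -/
structure IsErgodicProjection {A : VonNeumannAlgebra H} (T P : A.Elem →ₗ[ℂ] A.Elem) : Prop where
  mem_closure : ⇑P ∈ @closure _ (pointwiseWeakStarTopology A)
    ((fun Φ : Module.End ℂ A.Elem => (Φ : A.Elem → A.Elem)) ''
      convexHull ℝ {Φ : Module.End ℂ A.Elem | ∃ n : ℕ, 1 ≤ n ∧ Φ = (T : Module.End ℂ A.Elem) ^ n})
  map_comp : T ∘ₗ P = P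
  comp_map : P ∘ₗ T = P
  idempotent : P ∘ₗ P = P

/-- `T` is weak⋆ mean ergodic if it has a normal ergodic projection. -/
def IsWeakStarMeanErgodic {A : VonNeumannAlgebra H} (T : A.Elem →ₗ[ℂ] A.Elem) : Prop :=
  ∃ P : A.Elem →ₗ[ℂ] A.Elem, IsErgodicProjection T P ∧ IsNormalMap P

/-- The compression `x ↦ p x p`. -/
noncomputable def compression {A : VonNeumannAlgebra H} (p : A.Elem) : A.Elem →ₗ[ℂ] A.Elem :=
  LinearMap.mulLeftRight ℂ (p, p)

theorem compression_apply {A : VonNeumannAlgebra H} (p x : A.Elem) :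
    compression p x = p * x * p := rfl

/-- The Choi–Effros product `a ⋄ b = P (a b)`. -/
noncomputable def choiEffrosMul {A : VonNeumannAlgebra H} (P : A.Elem →ₗ[ℂ] A.Elem) (a b : A.Elem) : A.Elem :=
  P (a * b)

/-- The linear map `J` restricts to a ⋆-isomorphism from `B`, a ⋆-algebra with the product of `A`,
onto `F` with the product `mul`; both carry the involution of `A`. -/
structure IsStarIsomorphism {A : VonNeumannAlgebra H} (B F : Submodule ℂ A.Elem)
    (mul : A.Elem → A.Elem → A.Elem) (J : A.Elem →ₗ[ℂ] A.Elem) : Prop where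
  mul_mem : ∀ x ∈ B, ∀ y ∈ B, x * y ∈ B
  star_mem : ∀ x ∈ B, star x ∈ B
  bijOn : Set.BijOn J B F
  map_mul : ∀ x ∈ B, ∀ y ∈ B, J (x * y) = mul (J x) (J y)
  map_star : ∀ x ∈ B, J (star x) = star (J x)

/-- `p_R (Fix T) p_R`. -/
noncomputable def recurrentFixedSpace {A : VonNeumannAlgebra H} (T : A.Elem →ₗ[ℂ] A.Elem) :
    Submodule ℂ A.Elem :=
  (fixedSpace T).map (compression (maxPosRec T))

end VonNeumannAlgebra

open VonNeumannAlgebra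

/-! All four conditions are compared with (ii), `P p_R = 1`, where `p_R` is `maxPosRec T`. Complete
positivity enters only through the Schwarz inequality. That inequality survives convex combinations
and pointwise weak⋆ limits, so every ergodic projection `P` satisfies it too. Such a `P` exists as
an ultrafilter limit of Cesàro means; it fixes `Fix T` pointwise and preserves every stationary
normal state.

The projection `p_R` acts through one principle, `mul_maxPosRec_eq_zero_of_nonneg`: a positive `y`
on which all stationary normal states vanish satisfies `y p_R = 0`. It gives `p_R ≤ T p_R` and `p_R
≤ P p_R`. When `P p_R = 1`, Cauchy–Schwarz shows that `P` ignores `1 - p_R` on either side, so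
compression to `p_R` is inverted on `Fix T` by `P`. With the Choi–Effros identity the same principle
shows that fixed points commute with `p_R`, and that on its corner `y ⋄ z` is the ordinary product.
This yields (iii), (iv) and the Poisson integral. Conversely, both `1` and `P p_R` compress to
`p_R`, so (iii) forces `P p_R = 1`; a ⋆-isomorphism preserves units, so (iv) does. If `P` is normal,
`φ ∘ P` is a stationary normal state for each normal state `φ`, hence takes the value `1` at `p_R`.

The hard step is (ii) ⇒ (i). The vectors `v` for which `x ↦ ⟨v, P(x) v⟩` is normal form a closed
subspace invariant under the commutant. It contains the vectors representing any stationary state,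
by domination, and therefore the range of `p_R`. So the compression of `P` to `p_R` is normal. For a
normal state `φ` and `x ≥ 0` the numbers `φ(T^n(p_R P(x) p_R))` increase to `φ(P x)`, because `T^n
p_R` increases to `1`; the increments are normal by domination (`IsNormalPositive.of_le`), hence so
is their sum `φ ∘ P`. -/

section

open scoped ComplexOrder
open Filter Topology

set_option linter.unusedSectionVars false

namespace VonNeumannAlgebra

variable {H : Type u} [NormedAddCommGroup H] [InnerProductSpace ℂ H] [CompleteSpace H]
  {A : VonNeumannAlgebra H}

/-! ### Normal positive functionals -/

theorem hasSum_norm_inner_sq {κ : Type*} (b : HilbertBasis κ ℂ H) (v : H) :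
    HasSum (fun k => ‖⟪b k, v⟫_ℂ‖ ^ 2) (‖v‖ ^ 2) := by
  have h := b.hasSum_inner_mul_inner v v
  rw [inner_self_eq_norm_sq_to_K] at h
  rw [← Complex.hasSum_ofReal]
  convert! h using 2 with k
  · rw [← inner_conj_symm v (b k), RCLike.conj_mul]
    norm_cast
  · norm_cast

theorem summable_norm_inner_sq_prod {ι κ : Type*} (b : HilbertBasis κ ℂ H) {ξ : ι → H}
    (hξ : Summable fun i => ‖ξ i‖ ^ 2) :
    Summable fun q : ι × κ => ‖⟪b q.2, ξ q.1⟫_ℂ‖ ^ 2 := by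
  refine (summable_prod_of_nonneg fun _ => by positivity).2
    ⟨fun i => (hasSum_norm_inner_sq b (ξ i)).summable, ?_⟩
  simpa only [(hasSum_norm_inner_sq b _).tsum_eq] using hξ

/-- Parseval's identity for a pair of square summable families, as a double sum. -/
theorem hasSum_inner_mul_inner_prod {ι κ : Type*} (b : HilbertBasis κ ℂ H) {ξ η : ι → H}
    (hξ : Summable fun i => ‖ξ i‖ ^ 2) (hη : Summable fun i => ‖η i‖ ^ 2) {t : ℂ}
    (ht : HasSum (fun i => ⟪η i, ξ i⟫_ℂ) t) :
    HasSum (fun q : ι × κ => ⟪η q.1, b q.2⟫_ℂ * ⟪b q.2, ξ q.1⟫_ℂ) t := by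
  have hs : Summable fun q : ι × κ => ⟪η q.1, b q.2⟫_ℂ * ⟪b q.2, ξ q.1⟫_ℂ := by
    refine Summable.of_norm_bounded ((summable_norm_inner_sq_prod b hη).add
      (summable_norm_inner_sq_prod b hξ)) fun q => ?_
    rw [norm_mul, norm_inner_symm (η q.1)]
    nlinarith [sq_nonneg (‖⟪b q.2, η q.1⟫_ℂ‖ - ‖⟪b q.2, ξ q.1⟫_ℂ‖),
      sq_nonneg ‖⟪b q.2, η q.1⟫_ℂ‖, sq_nonneg ‖⟪b q.2, ξ q.1⟫_ℂ‖]
  have h1 := hs.hasSum.prod_fiberwise fun i => b.hasSum_inner_mul_inner (η i) (ξ i)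
  rw [ht.unique h1]
  exact hs.hasSum

theorem summable_norm_apply_sq {ι : Type*} {ξ : ι → H} (hξ : Summable fun i => ‖ξ i‖ ^ 2)
    (x : H →L[ℂ] H) : Summable fun i => ‖x (ξ i)‖ ^ 2 := by
  refine Summable.of_nonneg_of_le (fun i => by positivity) (fun i => ?_) (hξ.mul_left (‖x‖ ^ 2))
  rw [← mul_pow]
  gcongr
  exact x.le_opNorm _

theorem norm_inner_apply_le (x : H →L[ℂ] H) (v : H) : ‖⟪v, x v⟫_ℂ‖ ≤ ‖x‖ * ‖v‖ ^ 2 := by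
  calc ‖⟪v, x v⟫_ℂ‖ ≤ ‖v‖ * ‖x v‖ := norm_inner_le_norm _ _
    _ ≤ ‖v‖ * (‖x‖ * ‖v‖) := by gcongr; exact x.le_opNorm _
    _ = ‖x‖ * ‖v‖ ^ 2 := by ring

/-- Normal positive functionals on `A`: the functionals `x ↦ tr (ρ x)` with `0 ≤ ρ`. -/
def IsNormalPositive (φ : A.Elem →ₗ[ℂ] ℂ) : Prop :=
  ∃ ρ : H →L[ℂ] H, 0 ≤ ρ ∧ ∀ x : A.Elem, HasTrace (ρ * (x : H →L[ℂ] H)) (φ x)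

theorem HasTrace.unique {x : H →L[ℂ] H} {s t : ℂ} (hs : HasTrace x s) (ht : HasTrace x t) :
    s = t := by
  obtain ⟨w, b, -⟩ := exists_hilbertBasis ℂ H
  exact (hs w b).unique (ht w b)

theorem isNormalState_iff {φ : A.Elem →ₗ[ℂ] ℂ} :
    IsNormalState φ ↔ IsNormalPositive φ ∧ φ 1 = 1 := by
  constructor
  · rintro ⟨ρ, hρ, h⟩
    refine ⟨⟨ρ, hρ.nonneg, h⟩, ?_⟩
    have h1 := h 1
    rw [OneMemClass.coe_one, mul_one] at h1
    exact h1.unique hρ.trace_eq_one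
  · rintro ⟨⟨ρ, hρ, h⟩, h1⟩
    refine ⟨ρ, ⟨hρ, ?_⟩, h⟩
    have := h 1
    rwa [OneMemClass.coe_one, mul_one, h1] at this

/-- The density is `ρ = ∑ |ξ i⟩⟨ξ i|`, convergent in norm. Its trace against `x` in a basis is a
double Parseval sum, absolutely convergent, so the two summations may be exchanged. -/
theorem IsNormalPositive.of_hasSum {ι : Type*} {φ : A.Elem →ₗ[ℂ] ℂ} {ξ : ι → H}
    (hξ : Summable fun i => ‖ξ i‖ ^ 2)
    (h : ∀ x : A.Elem, HasSum (fun i => ⟪ξ i, (x : H →L[ℂ] H) (ξ i)⟫_ℂ) (φ x)) :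
    IsNormalPositive φ := by
  have hs : Summable fun i => InnerProductSpace.rankOne ℂ (ξ i) (ξ i) := by
    refine Summable.of_norm ?_
    simpa [sq] using hξ
  refine ⟨∑' i, InnerProductSpace.rankOne ℂ (ξ i) (ξ i), tsum_nonneg fun i => ?_, ?_⟩
  · rw [ContinuousLinearMap.nonneg_iff_isPositive]
    exact InnerProductSpace.isPositive_rankOne_self _
  intro x κ b
  have hη := summable_norm_apply_sq hξ (star (x : H →L[ℂ] H))
  have ht : HasSum (fun i => ⟪star (x : H →L[ℂ] H) (ξ i), ξ i⟫_ℂ) (φ x) := by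
    simpa only [ContinuousLinearMap.star_eq_adjoint, ContinuousLinearMap.adjoint_inner_left]
      using h x
  have h2 := (Equiv.prodComm κ ι).hasSum_iff.2 (hasSum_inner_mul_inner_prod b hξ hη ht)
  refine h2.prod_fiberwise fun k => ?_
  have h3 := hs.hasSum.mapL (ContinuousLinearMap.apply ℂ H ((x : H →L[ℂ] H) (b k)))
  have h4 := h3.mapL (innerSL ℂ (b k))
  convert! h4 using 2 with i
  simp [ContinuousLinearMap.star_eq_adjoint, ContinuousLinearMap.adjoint_inner_left]

/-- Take `ξ i = ρ^(1/2) b i` for an orthonormal basis `b`. Replacing `tr (ρ x)` by `tr (ρ^(1/2) x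
ρ^(1/2))` is again an exchange of summations in a double Parseval sum. From here on, normality is
handled through such vector families. -/
theorem IsNormalPositive.exists_vectors {φ : A.Elem →ₗ[ℂ] ℂ} (hφ : IsNormalPositive φ) :
    ∃ (ι : Type u) (ξ : ι → H), Summable (fun i => ‖ξ i‖ ^ 2) ∧
      ∀ x : A.Elem, HasSum (fun i => ⟪ξ i, (x : H →L[ℂ] H) (ξ i)⟫_ℂ) (φ x) := by
  obtain ⟨ρ, hρ, h⟩ := hφ
  obtain ⟨w, b, -⟩ := exists_hilbertBasis ℂ H
  set s : H →L[ℂ] H := CFC.sqrt ρ with hs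
  have hss : s * s = ρ := CFC.sqrt_mul_sqrt_self _ hρ
  have hsa : ∀ u v : H, ⟪s u, v⟫_ℂ = ⟪u, s v⟫_ℂ := fun u v => by
    have h1 : star s = s := (IsSelfAdjoint.of_nonneg (CFC.sqrt_nonneg _)).star_eq
    nth_rw 1 [← h1]
    rw [ContinuousLinearMap.star_eq_adjoint, ContinuousLinearMap.adjoint_inner_left]
  have hsum : Summable fun i => ‖s (b i)‖ ^ 2 := by
    have h1 := (Complex.hasSum_re (h 1 w b)).summable
    convert! h1 using 2 with i
    rw [OneMemClass.coe_one, mul_one, ← hss, mul_apply_eq_comp, ← hsa,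
      inner_self_eq_norm_sq_to_K]
    norm_cast
  refine ⟨w, fun i => s (b i), hsum, fun x => ?_⟩
  have hη := summable_norm_apply_sq hsum (star (x : H →L[ℂ] H))
  have hsx : Summable fun i => ⟪s (b i), (x : H →L[ℂ] H) (s (b i))⟫_ℂ :=
    Summable.of_norm_bounded (hsum.mul_left ‖(x : H →L[ℂ] H)‖) fun i => norm_inner_apply_le _ _
  have ht : HasSum (fun i => ⟪star (x : H →L[ℂ] H) (s (b i)), s (b i)⟫_ℂ)
      (∑' i, ⟪s (b i), (x : H →L[ℂ] H) (s (b i))⟫_ℂ) := by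
    simpa only [ContinuousLinearMap.star_eq_adjoint, ContinuousLinearMap.adjoint_inner_left]
      using hsx.hasSum
  have h2 := (Equiv.prodComm w w).hasSum_iff.2 (hasSum_inner_mul_inner_prod b hsum hη ht)
  have h3 : HasSum (fun i => ⟪b i, (ρ * (x : H →L[ℂ] H)) (b i)⟫_ℂ)
      (∑' i, ⟪s (b i), (x : H →L[ℂ] H) (s (b i))⟫_ℂ) := by
    refine h2.prod_fiberwise fun i => ?_
    have h4 := b.hasSum_inner_mul_inner (s (b i)) (s ((x : H →L[ℂ] H) (b i)))
    have h5 : ⟪b i, (ρ * (x : H →L[ℂ] H)) (b i)⟫_ℂ = ⟪s (b i), s ((x : H →L[ℂ] H) (b i))⟫_ℂ := by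
      rw [← hss, hsa]; rfl
    rw [h5]
    convert! h4 using 2 with j
    simp only [Function.comp, Equiv.prodComm_apply, Prod.swap, ContinuousLinearMap.star_eq_adjoint,
      ContinuousLinearMap.adjoint_inner_left]
    rw [hsa, hsa, mul_comm]
  rw [(h x w b).unique h3]
  exact hsx.hasSum

/-- The functional `x ↦ ⟨u, x v⟩`. -/
noncomputable def vectorForm (u v : H) : A.Elem →ₗ[ℂ] ℂ where
  toFun x := ⟪u, (x : H →L[ℂ] H) v⟫_ℂ
  map_add' x y := by simp
  map_smul' c x := by simp

@[simp]
theorem vectorForm_apply (u v : H) (x : A.Elem) :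
    vectorForm u v x = ⟪u, (x : H →L[ℂ] H) v⟫_ℂ := rfl

theorem isNormalPositive_vectorForm (v : H) : IsNormalPositive (vectorForm v v : A.Elem →ₗ[ℂ] ℂ) :=
  .of_hasSum (ι := Unit) (ξ := fun _ => v) (hasSum_fintype _).summable
    fun x => by simp

theorem IsNormalPositive.smul {φ : A.Elem →ₗ[ℂ] ℂ} (hφ : IsNormalPositive φ) {c : ℝ} (hc : 0 ≤ c) :
    IsNormalPositive ((c : ℂ) • φ) := by
  obtain ⟨ρ, hρ, h⟩ := hφ
  refine ⟨(c : ℂ) • ρ, smul_nonneg (by exact_mod_cast hc) hρ, fun x ι b => ?_⟩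
  simpa [inner_smul_right] using (h x ι b).mul_left (c : ℂ)

/-- The vector families of all `φ k` are joined into one; convergence at `1` is what makes the joint
family square summable. -/
theorem IsNormalPositive.hasSum {κ : Type*} {φ : κ → A.Elem →ₗ[ℂ] ℂ} {ψ : A.Elem →ₗ[ℂ] ℂ}
    (hφ : ∀ k, IsNormalPositive (φ k)) (h : ∀ x, HasSum (fun k => φ k x) (ψ x)) :
    IsNormalPositive ψ := by
  choose ι ξ hξ hx using fun k => (hφ k).exists_vectors
  have h1 : ∀ k, HasSum (fun i => ‖ξ k i‖ ^ 2) (φ k 1).re := fun k => by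
    have := Complex.hasSum_re (hx k 1)
    convert! this using 2 with i
    simp only [OneMemClass.coe_one, one_apply_eq_self, inner_self_eq_norm_sq_to_K]
    norm_cast
  have hs : Summable fun q : Σ k, ι k => ‖ξ q.1 q.2‖ ^ 2 := by
    refine (summable_sigma_of_nonneg fun _ => by positivity).2 ⟨hξ, ?_⟩
    simp only [(h1 _).tsum_eq]
    exact (Complex.hasSum_re (h 1)).summable
  refine .of_hasSum hs fun x => ?_
  have hsx : Summable fun q : Σ k, ι k => ⟪ξ q.1 q.2, (x : H →L[ℂ] H) (ξ q.1 q.2)⟫_ℂ :=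
    Summable.of_norm_bounded (hs.mul_left ‖(x : H →L[ℂ] H)‖) fun i => norm_inner_apply_le _ _
  have h2 := hsx.hasSum.sigma fun k => hx k x
  rw [(h x).unique h2]
  exact hsx.hasSum

theorem IsNormalPositive.add {φ ψ : A.Elem →ₗ[ℂ] ℂ} (hφ : IsNormalPositive φ)
    (hψ : IsNormalPositive ψ) : IsNormalPositive (φ + ψ) := by
  refine .hasSum (κ := Bool) (φ := fun b => if b then φ else ψ) (fun b => by cases b <;> simpa)
    fun x => ?_
  simpa using hasSum_fintype fun b : Bool => (if b then φ else ψ) x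

theorem elem_nonneg_iff {x : A.Elem} : 0 ≤ x ↔ ∀ v : H, 0 ≤ ⟪v, (x : H →L[ℂ] H) v⟫_ℂ := by
  rw [← Subtype.coe_le_coe, ZeroMemClass.coe_zero, ContinuousLinearMap.nonneg_iff_isPositive]
  constructor
  · exact fun h v => h.inner_nonneg_right v
  · intro h
    rw [ContinuousLinearMap.isPositive_iff_complex]
    intro v
    obtain ⟨h2, h3⟩ := Complex.nonneg_iff.1 (h v)
    rw [← inner_conj_symm]
    refine ⟨Complex.ext (by simp) ?_, ?_⟩
    · rw [Complex.conj_im, ← h3]; simp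
    · rwa [RCLike.re_to_complex, Complex.conj_re]

theorem IsNormalPositive.nonneg {φ : A.Elem →ₗ[ℂ] ℂ} (hφ : IsNormalPositive φ) {x : A.Elem}
    (hx : 0 ≤ x) : 0 ≤ φ x := by
  obtain ⟨ι, ξ, -, h⟩ := hφ.exists_vectors
  exact (h x).nonneg fun i => elem_nonneg_iff.1 hx _

end VonNeumannAlgebra

/-! ### Domination of positive functionals -/

namespace PositiveLinearMap

variable {A : Type*} [CStarAlgebra A] [PartialOrder A] [StarOrderedRing A] (f : A →ₚ[ℂ] ℂ)

/-- The canonical linear map of a C⋆-algebra to the GNS space of a positive functional. -/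
noncomputable def toGNS : A →ₗ[ℂ] f.GNS :=
  (UniformSpace.Completion.toComplL (𝕜 := ℂ) (E := f.PreGNS)).toLinearMap ∘ₗ f.toPreGNS.toLinearMap

theorem toGNS_apply (x : A) : f.toGNS x = ((f.toPreGNS x : f.PreGNS) : f.GNS) := rfl

theorem denseRange_toGNS : DenseRange f.toGNS :=
  UniformSpace.Completion.denseRange_coe.comp f.toPreGNS.surjective.denseRange
    (UniformSpace.Completion.continuous_coe _)

theorem inner_toGNS (x y : A) : ⟪f.toGNS x, f.toGNS y⟫_ℂ = f (star x * y) := by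
  rw [toGNS_apply, toGNS_apply, UniformSpace.Completion.inner_coe, preGNS_inner_def]
  rfl

theorem gnsStarAlgHom_toGNS (x y : A) : f.gnsStarAlgHom x (f.toGNS y) = f.toGNS (x * y) := by
  simp [toGNS_apply]

theorem norm_sq_toGNS (x : A) : ‖f.toGNS x‖ ^ 2 = (f (star x * x)).re := by
  rw [← inner_toGNS, inner_self_eq_norm_sq_to_K]
  norm_cast

/-- A linear map dominated by the GNS seminorm factors through the GNS space. -/
theorem exists_factor_toGNS {K : Type*} [NormedAddCommGroup K] [NormedSpace ℂ K] [CompleteSpace K]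
    (g : A →ₗ[ℂ] K) (hg : ∀ x, ‖g x‖ ^ 2 ≤ (f (star x * x)).re) :
    ∃ F : f.GNS →L[ℂ] K, ∀ x, F (f.toGNS x) = g x := by
  refine ⟨g.extendOfNorm f.toGNS, LinearMap.extendOfNorm_eq f.denseRange_toGNS ⟨1, fun x => ?_⟩⟩
  rw [one_mul]
  refine le_of_sq_le_sq ?_ (norm_nonneg _)
  rw [norm_sq_toGNS]
  exact hg x

/-- A positive functional dominated by `f` is a vector functional in the GNS representation
of `f`. -/
theorem exists_vector_of_le (g : A →ₚ[ℂ] ℂ) (hgf : ∀ x, 0 ≤ x → g x ≤ f x) :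
    ∃ η : f.GNS, ∀ y, g y = ⟪η, f.gnsStarAlgHom y η⟫_ℂ := by
  obtain ⟨V, hV⟩ := f.exists_factor_toGNS g.toGNS fun x => by
    rw [norm_sq_toGNS]
    exact (Complex.le_def.1 (hgf _ (star_mul_self_nonneg x))).1
  have hint : ∀ y, V ∘L f.gnsStarAlgHom y = g.gnsStarAlgHom y ∘L V := fun y => by
    refine DFunLike.coe_injective
      (f.denseRange_toGNS.equalizer (by fun_prop) (by fun_prop) (funext fun x => ?_))
    simp only [Function.comp, ContinuousLinearMap.comp_apply, hV, gnsStarAlgHom_toGNS]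
  -- `V` intertwines the two GNS representations, so `t = V⋆ V` and its square root commute with the
  -- representation of `f`. The vector sought is the square root of `t` applied to the cyclic
  -- vector.
  set t : f.GNS →L[ℂ] f.GNS := ContinuousLinearMap.adjoint V ∘L V with ht
  have ht0 : 0 ≤ t := by
    rw [ContinuousLinearMap.nonneg_iff_isPositive]
    exact V.isPositive_adjoint_comp_self
  have hcomm : ∀ y, Commute t (f.gnsStarAlgHom y) := fun y => by
    have h1 : f.gnsStarAlgHom y ∘L ContinuousLinearMap.adjoint V =
        ContinuousLinearMap.adjoint V ∘L g.gnsStarAlgHom y := by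
      have h2 := congrArg ContinuousLinearMap.adjoint (hint (star y))
      rw [ContinuousLinearMap.adjoint_comp, ContinuousLinearMap.adjoint_comp,
        map_star f.gnsStarAlgHom, map_star g.gnsStarAlgHom,
        ContinuousLinearMap.star_eq_adjoint, ContinuousLinearMap.star_eq_adjoint,
        ContinuousLinearMap.adjoint_adjoint, ContinuousLinearMap.adjoint_adjoint] at h2
      exact h2
    change (ContinuousLinearMap.adjoint V ∘L V) ∘L f.gnsStarAlgHom y =
      f.gnsStarAlgHom y ∘L (ContinuousLinearMap.adjoint V ∘L V)
    rw [ContinuousLinearMap.comp_assoc, hint, ← ContinuousLinearMap.comp_assoc,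
      ← ContinuousLinearMap.comp_assoc, h1]
  set s : f.GNS →L[ℂ] f.GNS := CFC.sqrt t with hs
  have hss : s * s = t := CFC.sqrt_mul_sqrt_self _ ht0
  have hsa : star s = s := (IsSelfAdjoint.of_nonneg (CFC.sqrt_nonneg _)).star_eq
  have hsc : ∀ y, Commute s (f.gnsStarAlgHom y) := fun y =>
    Commute.cfcₙ_nnreal (hcomm y) NNReal.sqrt
  refine ⟨s (f.toGNS 1), fun y => ?_⟩
  have h3 : f.gnsStarAlgHom y (s (f.toGNS 1)) = s (f.toGNS y) := by
    have := congrArg (fun z : f.GNS →L[ℂ] f.GNS => z (f.toGNS 1)) (hsc y).eq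
    simp only [mul_apply_eq_comp] at this
    rw [← this, gnsStarAlgHom_toGNS, mul_one]
  rw [h3, ← hsa, ContinuousLinearMap.star_eq_adjoint, ContinuousLinearMap.adjoint_inner_left,
    ← ContinuousLinearMap.star_eq_adjoint, hsa]
  have h4 : s (s (f.toGNS y)) = ContinuousLinearMap.adjoint V (V (f.toGNS y)) :=
    congrArg (fun z : f.GNS →L[ℂ] f.GNS => z (f.toGNS y)) hss
  rw [h4, ContinuousLinearMap.adjoint_inner_right, hV, hV, inner_toGNS, star_one, one_mul]

end PositiveLinearMap

namespace VonNeumannAlgebra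

variable {H : Type u} [NormedAddCommGroup H] [InnerProductSpace ℂ H] [CompleteSpace H]
  {A : VonNeumannAlgebra H}

/-- A positive functional dominated by a normal one is normal. -/
theorem IsNormalPositive.of_le {φ ψ : A.Elem →ₗ[ℂ] ℂ} (hψ : IsNormalPositive ψ)
    (h0 : ∀ x, 0 ≤ x → 0 ≤ φ x) (h : ∀ x, 0 ≤ x → φ x ≤ ψ x) : IsNormalPositive φ := by
  obtain ⟨ι, ξ, hξ, hx⟩ := hψ.exists_vectors
  set f : A.Elem →ₚ[ℂ] ℂ := PositiveLinearMap.mk₀ ψ fun x hx => hψ.nonneg hx with hf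
  set g : A.Elem →ₚ[ℂ] ℂ := PositiveLinearMap.mk₀ φ h0 with hg
  have hmem : ∀ x : A.Elem, Memℓp (fun i => (x : H →L[ℂ] H) (ξ i)) 2 := fun x =>
    memℓp_gen (by simpa using summable_norm_apply_sq hξ (x : H →L[ℂ] H))
  -- The map `x ↦ (x ξ i)_i` extends to an isometry of the GNS space of `ψ` into `ℓ²(ι, H)` that
  -- intertwines the actions of `A`. A vector functional on the GNS space thus becomes a sum of
  -- vector functionals on `H`.
  let W₀ : A.Elem →ₗ[ℂ] lp (fun _ : ι => H) 2 :=
    { toFun x := ⟨fun i => (x : H →L[ℂ] H) (ξ i), hmem x⟩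
      map_add' x y := Subtype.ext (funext fun i => rfl)
      map_smul' c x := Subtype.ext (funext fun i => rfl) }
  have hW₀ : ∀ x y, ⟪W₀ x, W₀ y⟫_ℂ = ψ (star x * y) := fun x y => by
    refine (lp.hasSum_inner (W₀ x) (W₀ y)).unique ?_
    convert! hx (star x * y) using 2 with i
    change ⟪(x : H →L[ℂ] H) (ξ i), (y : H →L[ℂ] H) (ξ i)⟫_ℂ =
      ⟪ξ i, (star (x : H →L[ℂ] H)) ((y : H →L[ℂ] H) (ξ i))⟫_ℂ
    rw [ContinuousLinearMap.star_eq_adjoint, ContinuousLinearMap.adjoint_inner_right]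
  obtain ⟨W, hW⟩ := f.exists_factor_toGNS W₀ fun x => by
    have h1 := hW₀ x x
    rw [inner_self_eq_norm_sq_to_K] at h1
    have h2 : (f (star x * x)) = ψ (star x * x) := rfl
    rw [h2, ← h1]
    norm_cast
  have hWi : ∀ u v, ⟪W u, W v⟫_ℂ = ⟪u, v⟫_ℂ := fun u v => by
    refine f.denseRange_toGNS.induction_on₂
      (p := fun u v => ⟪W u, W v⟫_ℂ = ⟪u, v⟫_ℂ) (isClosed_eq (by fun_prop) (by fun_prop)) ?_ u v
    intro x y
    rw [hW, hW, hW₀, f.inner_toGNS]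
    rfl
  have hWc : ∀ (y : A.Elem) (v : f.GNS) (i : ι),
      (W (f.gnsStarAlgHom y v) : ∀ _ : ι, H) i = (y : H →L[ℂ] H) ((W v : ∀ _ : ι, H) i) := by
    intro y v i
    have hc : Continuous fun v : lp (fun _ : ι => H) 2 => (v : ∀ _ : ι, H) i :=
      (lp.lipschitzWith_one_eval 2 i).continuous
    refine f.denseRange_toGNS.induction_on (p := fun v =>
      (W (f.gnsStarAlgHom y v) : ∀ _ : ι, H) i = (y : H →L[ℂ] H) ((W v : ∀ _ : ι, H) i)) v
      (isClosed_eq (hc.comp (by fun_prop)) ((y : H →L[ℂ] H).continuous.comp (hc.comp (by fun_prop))))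
      fun x => ?_
    rw [f.gnsStarAlgHom_toGNS, hW, hW]
    rfl
  obtain ⟨η, hη⟩ := f.exists_vector_of_le g h
  refine .of_hasSum (ξ := fun i => (W η : ∀ _ : ι, H) i) ?_ fun y => ?_
  · simpa using (lp.memℓp (W η)).summable (by simp)
  · have h1 : φ y = ⟪η, f.gnsStarAlgHom y η⟫_ℂ := hη y
    rw [h1, ← hWi]
    simpa only [hWc] using lp.hasSum_inner (W η) (W (f.gnsStarAlgHom y η))

end VonNeumannAlgebra

namespace VonNeumannAlgebra

variable {H : Type u} [NormedAddCommGroup H] [InnerProductSpace ℂ H] [CompleteSpace H]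
  {A : VonNeumannAlgebra H}

/-! ### Convergence in the weak⋆ topology -/

/-- The weak⋆ topology tests against states only; this normalization extends convergence to all
normal positive functionals, and then by polarization to the forms `⟨u, x v⟩`. -/
theorem IsNormalPositive.eq_zero_or_smul {φ : A.Elem →ₗ[ℂ] ℂ} (hφ : IsNormalPositive φ) :
    φ = 0 ∨ ∃ (c : ℝ) (χ : A.Elem →ₗ[ℂ] ℂ), 0 ≤ c ∧ IsNormalState χ ∧ φ = (c : ℂ) • χ := by
  obtain ⟨h1, h2⟩ := Complex.nonneg_iff.1 (hφ.nonneg (zero_le_one (α := A.Elem)))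
  have h3 : φ 1 = ((φ 1).re : ℂ) := Complex.ext rfl (by simp [← h2])
  rcases h1.eq_or_lt with h0 | h0
  · left
    obtain ⟨ι, ξ, hξ, hx⟩ := hφ.exists_vectors
    have h4 : HasSum (fun i => ‖ξ i‖ ^ 2) 0 := by
      have := Complex.hasSum_re (hx 1)
      rw [← h0] at this
      convert! this using 2 with i
      simp only [OneMemClass.coe_one, one_apply_eq_self, inner_self_eq_norm_sq_to_K]
      norm_cast
    have h5 : ∀ i, ξ i = 0 := fun i => by
      have := (hasSum_zero_iff_of_nonneg fun i => by positivity).1 h4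
      simpa using congrFun this i
    ext x
    have := hx x
    simp only [h5, map_zero, inner_zero_left] at this
    exact this.unique hasSum_zero
  · right
    refine ⟨(φ 1).re, (((φ 1).re⁻¹ : ℝ) : ℂ) • φ, h1, ?_, ?_⟩
    · refine isNormalState_iff.2 ⟨hφ.smul (by positivity), ?_⟩
      rw [LinearMap.smul_apply, smul_eq_mul]
      nth_rw 2 [h3]
      rw [← Complex.ofReal_mul, inv_mul_cancel₀ h0.ne', Complex.ofReal_one]
    · rw [smul_smul, ← Complex.ofReal_mul, mul_inv_cancel₀ h0.ne', Complex.ofReal_one, one_smul]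

theorem tendsto_pointwiseWeakStar_iff {κ : Type*} {F : κ → A.Elem → A.Elem} {P : A.Elem → A.Elem}
    {L : Filter κ} : Tendsto F L (@nhds _ (pointwiseWeakStarTopology A) P) ↔
      ∀ x, ∀ φ : A.Elem →ₗ[ℂ] ℂ, IsNormalState φ →
        Tendsto (fun i => φ (F i x)) L (𝓝 (φ (P x))) := by
  rw [@tendsto_pi_nhds _ _ _ (fun _ => weakStarTopology A)]
  refine forall_congr' fun x => ?_
  rw [weakStarTopology, nhds_iInf, tendsto_iInf, Subtype.forall]
  refine forall₂_congr fun φ hφ => ?_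
  rw [nhds_induced, tendsto_comap_iff]
  rfl

theorem IsNormalPositive.tendsto {κ : Type*} {L : Filter κ} {f : κ → A.Elem} {x : A.Elem}
    (h : ∀ φ : A.Elem →ₗ[ℂ] ℂ, IsNormalState φ → Tendsto (fun i => φ (f i)) L (𝓝 (φ x)))
    {φ : A.Elem →ₗ[ℂ] ℂ} (hφ : IsNormalPositive φ) : Tendsto (fun i => φ (f i)) L (𝓝 (φ x)) := by
  obtain rfl | ⟨c, χ, hc, hχ, rfl⟩ := hφ.eq_zero_or_smul
  · simpa using tendsto_const_nhds
  · exact (h χ hχ).const_mul (c : ℂ)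

theorem vectorForm_eq (u v : H) : (vectorForm u v : A.Elem →ₗ[ℂ] ℂ) = (4⁻¹ : ℂ) •
    (vectorForm (u + v) (u + v) - vectorForm (u - v) (u - v)
      - Complex.I • vectorForm (u + Complex.I • v) (u + Complex.I • v)
      + Complex.I • vectorForm (u - Complex.I • v) (u - Complex.I • v)) := by
  ext x
  simp only [vectorForm_apply, LinearMap.smul_apply, LinearMap.add_apply, LinearMap.sub_apply,
    inner_add_left, inner_add_right, inner_sub_left, inner_sub_right, map_add, map_sub, map_smul,
    inner_smul_left, inner_smul_right, smul_eq_mul, Complex.conj_I]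
  linear_combination (⟪u, (x : H →L[ℂ] H) v⟫_ℂ / 2 - ⟪v, (x : H →L[ℂ] H) u⟫_ℂ / 2) * Complex.I_sq

theorem tendsto_vectorForm {κ : Type*} {L : Filter κ} {f : κ → A.Elem} {x : A.Elem}
    (h : ∀ φ : A.Elem →ₗ[ℂ] ℂ, IsNormalState φ → Tendsto (fun i => φ (f i)) L (𝓝 (φ x)))
    (u v : H) : Tendsto (fun i => vectorForm u v (f i)) L (𝓝 (vectorForm u v x)) := by
  have key := fun w : H => (isNormalPositive_vectorForm (A := A) w).tendsto h
  simp only [vectorForm_eq u v, LinearMap.smul_apply, LinearMap.add_apply, LinearMap.sub_apply,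
    smul_eq_mul]
  exact (((key _).sub (key _)).sub ((key _).const_mul _) |>.add ((key _).const_mul _)).const_mul _

theorem elem_ext {x y : A.Elem} (h : ∀ u v : H, vectorForm u v x = vectorForm u v y) : x = y := by
  refine Subtype.ext (ContinuousLinearMap.ext fun v => ext_inner_left ℂ fun u => ?_)
  exact h u v

theorem elem_ext_normal {x y : A.Elem} (h : ∀ φ : A.Elem →ₗ[ℂ] ℂ, IsNormalState φ → φ x = φ y) :
    x = y := by
  refine elem_ext fun u v => ?_
  have h1 := tendsto_vectorForm (L := (pure () : Filter Unit)) (f := fun _ => x) (x := y)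
    (fun φ hφ => by rw [h φ hφ]; exact tendsto_const_nhds) u v
  exact tendsto_nhds_unique tendsto_const_nhds h1

/-! ### Schwarz maps -/

/-- Unital linear maps with `S(x)⋆ S(x) ≤ S(x⋆ x)`. -/
structure IsSchwarzMap (S : A.Elem →ₗ[ℂ] A.Elem) : Prop where
  map_one : S 1 = 1
  schwarz : ∀ x, star (S x) * S x ≤ S (star x * x)

namespace IsSchwarzMap

variable {S : A.Elem →ₗ[ℂ] A.Elem}

theorem nonneg (hS : IsSchwarzMap S) {x : A.Elem} (hx : 0 ≤ x) : 0 ≤ S x := by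
  obtain ⟨s, rfl⟩ := CStarAlgebra.nonneg_iff_eq_star_mul_self.1 hx
  exact (star_mul_self_nonneg _).trans (hS.schwarz s)

theorem mono (hS : IsSchwarzMap S) {x y : A.Elem} (h : x ≤ y) : S x ≤ S y := by
  rw [← sub_nonneg, ← map_sub]
  exact hS.nonneg (sub_nonneg.2 h)

theorem map_star (hS : IsSchwarzMap S) (x : A.Elem) : S (star x) = star (S x) :=
  StarHomClass.map_star (PositiveLinearMap.mk₀ S fun _ hx => hS.nonneg hx) x

theorem comp {R : A.Elem →ₗ[ℂ] A.Elem} (hS : IsSchwarzMap S) (hR : IsSchwarzMap R) :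
    IsSchwarzMap (S ∘ₗ R) where
  map_one := by simp [hR.map_one, hS.map_one]
  schwarz x := (hS.schwarz (R x)).trans (hS.mono (hR.schwarz x))

theorem pow (hS : IsSchwarzMap S) (n : ℕ) : IsSchwarzMap ((S : Module.End ℂ A.Elem) ^ n) := by
  induction n with
  | zero => exact ⟨rfl, fun x => le_rfl⟩
  | succ n ih => exact ih.comp hS

end IsSchwarzMap

theorem inner_star_mul_self (x : A.Elem) (v : H) :
    ⟪v, ((star x * x : A.Elem) : H →L[ℂ] H) v⟫_ℂ = (‖(x : H →L[ℂ] H) v‖ : ℂ) ^ 2 := by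
  change ⟪v, (star (x : H →L[ℂ] H)) ((x : H →L[ℂ] H) v)⟫_ℂ = _
  rw [ContinuousLinearMap.star_eq_adjoint, ContinuousLinearMap.adjoint_inner_right,
    inner_self_eq_norm_sq_to_K]
  rfl

theorem elem_le_iff {x y : A.Elem} :
    x ≤ y ↔ ∀ v : H, vectorForm v v x ≤ vectorForm v v y := by
  rw [← sub_nonneg, elem_nonneg_iff]
  refine forall_congr' fun v => ?_
  rw [← sub_nonneg (a := vectorForm v v y), ← map_sub]
  rfl

/-- The operator inequality is restated so that `S` enters through scalars `⟨u, S(x) v⟩` only. In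
this form it visibly passes to convex combinations (convexity of the square) and to pointwise weak⋆
limits. -/
theorem isSchwarzMap_iff {S : A.Elem →ₗ[ℂ] A.Elem} :
    IsSchwarzMap S ↔ S 1 = 1 ∧ (∀ v x, (vectorForm v v (S (star x * x))).im = 0) ∧
      ∀ u v x, ‖vectorForm u v (S x)‖ ^ 2 ≤ ‖u‖ ^ 2 * (vectorForm v v (S (star x * x))).re := by
  constructor
  · intro hS
    refine ⟨hS.map_one, fun v x => ?_, fun u v x => ?_⟩
    · exact (Complex.nonneg_iff.1
        (elem_nonneg_iff.1 (hS.nonneg (star_mul_self_nonneg x)) v)).2.symm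
    · have h1 := (Complex.le_def.1 (elem_le_iff.1 (hS.schwarz x) v)).1
      rw [vectorForm_apply, inner_star_mul_self] at h1
      have h2 : ((‖(S x : H →L[ℂ] H) v‖ : ℂ) ^ 2).re = ‖(S x : H →L[ℂ] H) v‖ ^ 2 := by norm_cast
      rw [h2] at h1
      calc ‖vectorForm u v (S x)‖ ^ 2 ≤ (‖u‖ * ‖(S x : H →L[ℂ] H) v‖) ^ 2 := by
            gcongr; exact norm_inner_le_norm _ _
        _ ≤ _ := by rw [mul_pow]; gcongr
  · rintro ⟨h1, h2, h3⟩
    refine ⟨h1, fun x => elem_le_iff.2 fun v => ?_⟩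
    rw [vectorForm_apply, inner_star_mul_self, Complex.le_def]
    -- Testing with `u = S(x) v` gives `‖S(x) v‖⁴` on the left; one factor `‖S(x) v‖²` is then
    -- cancelled, and its vanishing needs a separate argument.
    have h4 := h3 ((S x : H →L[ℂ] H) v) v x
    rw [vectorForm_apply, inner_self_eq_norm_sq_to_K] at h4
    refine ⟨?_, by rw [h2]; norm_cast⟩
    have h5 : ((‖(S x : H →L[ℂ] H) v‖ : ℂ) ^ 2).re = ‖(S x : H →L[ℂ] H) v‖ ^ 2 := by norm_cast
    rw [h5]
    rcases (norm_nonneg ((S x : H →L[ℂ] H) v)).eq_or_lt with h0 | h0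
    · rw [← h0]
      by_cases hv : v = 0
      · simp [hv]
      · have h6 := h3 v v x
        have h7 : 0 < ‖v‖ ^ 2 := by positivity
        have h8 : 0 ≤ ‖v‖ ^ 2 * (vectorForm v v (S (star x * x))).re := le_trans (by positivity) h6
        have := nonneg_of_mul_nonneg_right h8 h7
        simpa using this
    · have h6 : ‖(‖(S x : H →L[ℂ] H) v‖ : ℂ) ^ 2‖ = ‖(S x : H →L[ℂ] H) v‖ ^ 2 := by simp
      erw [h6] at h4
      rw [sq (‖(S x : H →L[ℂ] H) v‖ ^ 2)] at h4
      exact le_of_mul_le_mul_left h4 (by positivity)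

theorem convex_isSchwarzMap : Convex ℝ {S : Module.End ℂ A.Elem | IsSchwarzMap S} := by
  intro S hS R hR a b ha hb hab
  simp only [Set.mem_ofPred_eq, isSchwarzMap_iff] at hS hR ⊢
  obtain ⟨hS1, hS2, hS3⟩ := hS
  obtain ⟨hR1, hR2, hR3⟩ := hR
  have hv : ∀ u v x, vectorForm u v ((a • S + b • R) x) =
      (a : ℂ) * vectorForm u v (S x) + b * vectorForm u v (R x) := fun u v x => by
    rw [LinearMap.add_apply, LinearMap.smul_apply, LinearMap.smul_apply, map_add,
      ← Complex.coe_smul, ← Complex.coe_smul, map_smul, map_smul, smul_eq_mul, smul_eq_mul]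
  refine ⟨?_, fun v x => ?_, fun u v x => ?_⟩
  · rw [LinearMap.add_apply, LinearMap.smul_apply, LinearMap.smul_apply, hS1, hR1, ← add_smul, hab,
      one_smul]
  · rw [hv, Complex.add_im, Complex.im_ofReal_mul, Complex.im_ofReal_mul, hS2, hR2]
    simp
  · rw [hv, hv, Complex.add_re, Complex.re_ofReal_mul, Complex.re_ofReal_mul]
    have h1 : ‖(a : ℂ) * vectorForm u v (S x) + b * vectorForm u v (R x)‖ ≤
        a * ‖vectorForm u v (S x)‖ + b * ‖vectorForm u v (R x)‖ := by
      refine (norm_add_le _ _).trans_eq ?_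
      rw [norm_mul, norm_mul, Complex.norm_of_nonneg ha, Complex.norm_of_nonneg hb]
    have h2 : (a * ‖vectorForm u v (S x)‖ + b * ‖vectorForm u v (R x)‖) ^ 2 ≤
        a * ‖vectorForm u v (S x)‖ ^ 2 + b * ‖vectorForm u v (R x)‖ ^ 2 := by
      simpa using (convexOn_pow 2).2 (norm_nonneg (vectorForm u v (S x)))
        (norm_nonneg (vectorForm u v (R x))) ha hb hab
    calc _ ≤ (a * ‖vectorForm u v (S x)‖ + b * ‖vectorForm u v (R x)‖) ^ 2 := by gcongr
      _ ≤ _ := h2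
      _ ≤ a * (‖u‖ ^ 2 * (vectorForm v v (S (star x * x))).re) +
          b * (‖u‖ ^ 2 * (vectorForm v v (R (star x * x))).re) := by
        gcongr
        exacts [hS3 u v x, hR3 u v x]
      _ = _ := by ring

theorem IsSchwarzMap.of_tendsto {κ : Type*} {L : Filter κ} [L.NeBot]
    {S : κ → A.Elem →ₗ[ℂ] A.Elem} {P : A.Elem →ₗ[ℂ] A.Elem} (hS : ∀ᶠ i in L, IsSchwarzMap (S i))
    (h : ∀ x, ∀ φ : A.Elem →ₗ[ℂ] ℂ, IsNormalState φ →
      Tendsto (fun i => φ (S i x)) L (𝓝 (φ (P x)))) : IsSchwarzMap P := by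
  have hv := fun x => tendsto_vectorForm (h x)
  refine isSchwarzMap_iff.2 ⟨elem_ext fun u v => ?_, fun v x => ?_, fun u v x => ?_⟩
  · refine tendsto_nhds_unique (hv 1 u v) (tendsto_const_nhds.congr' ?_)
    filter_upwards [hS] with i hi
    rw [hi.map_one]
  · refine tendsto_nhds_unique ((Complex.continuous_im.tendsto _).comp (hv _ v v))
      (tendsto_const_nhds.congr' ?_)
    filter_upwards [hS] with i hi
    exact ((isSchwarzMap_iff.1 hi).2.1 v x).symm
  · refine le_of_tendsto_of_tendsto ((hv x u v).norm.pow 2)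
      (((Complex.continuous_re.tendsto _).comp (hv _ v v)).const_mul _) ?_
    filter_upwards [hS] with i hi
    exact (isSchwarzMap_iff.1 hi).2.2 u v x

theorem _root_.CStarMatrix.apply_self_nonneg {n B : Type*} [Fintype n] [CStarAlgebra B]
    [PartialOrder B] [StarOrderedRing B] {M : CStarMatrix n n B} (hM : 0 ≤ M) (i : n) :
    0 ≤ M i i := by
  rw [StarOrderedRing.nonneg_iff] at hM
  induction hM using AddSubmonoid.closure_induction with
  | mem M h =>
    obtain ⟨N, rfl⟩ := h
    simp only [CStarMatrix.mul_apply, CStarMatrix.star_apply]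
    exact Finset.sum_nonneg fun k _ => star_mul_self_nonneg _
  | zero => exact le_rfl
  | add M N _ _ h1 h2 => exact add_nonneg h1 h2

open CStarMatrix in
theorem IsMarkovOperator.isSchwarzMap {T : A.Elem →ₗ[ℂ] A.Elem} (hT : IsMarkovOperator T) :
    IsSchwarzMap T := by
  obtain ⟨⟨Φ, rfl⟩, h1, -⟩ := hT
  refine ⟨h1, fun x => ?_⟩
  have hstar : Φ (star x) = star (Φ x) := map_star Φ x
  have hone : Φ 1 = 1 := h1
  -- `N₀⋆ N₀` has rows `(x⋆x, x⋆)` and `(x, 1)`. Conjugating its image under `Φ` by the column `(1,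
  -- -Φ x)` leaves `Φ(x⋆x) - Φ(x)⋆ Φ(x)` in the upper left corner.
  set N₀ : CStarMatrix (Fin 2) (Fin 2) A.Elem := ofMatrix !![x, 1; 0, 0] with hN₀
  have hM : 0 ≤ (star N₀ * N₀).map Φ := Φ.map_cstarMatrix_nonneg _ (star_mul_self_nonneg N₀)
  set N : CStarMatrix (Fin 2) (Fin 2) A.Elem := ofMatrix !![1, 0; - Φ x, 0] with hN
  have hQ := CStarMatrix.apply_self_nonneg (star_left_conjugate_nonneg hM N) 0
  simp [hN, hN₀, hstar, hone, CStarMatrix.mul_apply, CStarMatrix.star_apply] at hQ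
  exact hQ

end VonNeumannAlgebra

namespace VonNeumannAlgebra

variable {H : Type u} [NormedAddCommGroup H] [InnerProductSpace ℂ H] [CompleteSpace H]
  {A : VonNeumannAlgebra H}

/-! ### Existence of ergodic projections -/

theorem exists_tendsto_of_norm_le {κ : Type*} (U : Ultrafilter κ) {a : κ → ℂ} {C : ℝ}
    (h : ∀ i, ‖a i‖ ≤ C) : ∃ z, ‖z‖ ≤ C ∧ Tendsto a U (𝓝 z) := by
  obtain ⟨z, hz, hz'⟩ := (isCompact_closedBall (0 : ℂ) C).ultrafilter_le_nhds (U.map a)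
    (le_principal_iff.2 (Ultrafilter.mem_coe.2 (by
      rw [Ultrafilter.mem_map]
      exact Filter.univ_mem' fun i => by simpa using h i)))
  exact ⟨z, by simpa using hz, hz'⟩

/-- Weak⋆ compactness of bounded sets of a von Neumann algebra. -/
theorem exists_weakStar_limit {κ : Type*} (U : Ultrafilter κ) {f : κ → A.Elem} {C : ℝ}
    (hf : ∀ i, ‖f i‖ ≤ C) : ∃ x : A.Elem, ∀ φ : A.Elem →ₗ[ℂ] ℂ, IsNormalState φ →
      Tendsto (fun i => φ (f i)) U (𝓝 (φ x)) := by
  have hb : ∀ v w i, ‖⟪(f i : H →L[ℂ] H) v, w⟫_ℂ‖ ≤ C * ‖v‖ * ‖w‖ := fun v w i => by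
    refine (norm_inner_le_norm _ _).trans ?_
    gcongr
    exact ((f i : H →L[ℂ] H).le_opNorm v).trans (by gcongr; exact hf i)
  choose B hBn hB using fun v w => exists_tendsto_of_norm_le U (hb v w)
  let B₁ : H →ₗ⋆[ℂ] H →ₗ[ℂ] ℂ := LinearMap.mk₂'ₛₗ (starRingEnd ℂ) (RingHom.id ℂ) B
    (fun v v' w => tendsto_nhds_unique (hB _ _)
      (((hB v w).add (hB v' w)).congr fun i => by simp))
    (fun c v w => tendsto_nhds_unique (hB _ _)
      (((hB v w).const_mul (starRingEnd ℂ c)).congr fun i => by simp [mul_comm]))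
    (fun v w w' => tendsto_nhds_unique (hB _ _)
      (((hB v w).add (hB v w')).congr fun i => by simp))
    (fun c v w => tendsto_nhds_unique (hB _ _)
      (((hB v w).const_mul c).congr fun i => by simp))
  let x : H →L[ℂ] H := InnerProductSpace.continuousLinearMapOfBilin
    (LinearMap.mkContinuous₂ B₁ C hBn)
  have hx : ∀ v w, ⟪x v, w⟫_ℂ = B v w := fun v w =>
    InnerProductSpace.continuousLinearMapOfBilin_apply _ v w
  -- The limit commutes with the commutant, so the bicommutant theorem places it in `A`.
  have hmem : x ∈ A := by
    rw [← commutant_commutant A, mem_commutant_iff]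
    intro y hy
    refine ContinuousLinearMap.ext fun v => ext_inner_right ℂ fun w => ?_
    change ⟪y (x v), w⟫_ℂ = ⟪x (y v), w⟫_ℂ
    rw [← ContinuousLinearMap.adjoint_inner_right, hx, hx]
    refine tendsto_nhds_unique (hB _ _) ((hB _ _).congr fun i => ?_)
    rw [ContinuousLinearMap.adjoint_inner_right]
    have hc := (mem_commutant_iff.1 hy) _ (f i).2
    exact congrArg (fun z : H →L[ℂ] H => ⟪z v, w⟫_ℂ) hc
  refine ⟨⟨x, hmem⟩, fun φ hφ => ?_⟩
  obtain ⟨ι, ξ, hξ, hs⟩ := (isNormalState_iff.1 hφ).1.exists_vectors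
  -- The limit exists so far only for matrix coefficients; the bound `C ‖ξ j‖²` carries it through
  -- the sum defining `φ`.
  have hlim := tendsto_tsum_of_dominated_convergence (𝓕 := (U : Filter κ))
    (f := fun i j => ⟪ξ j, (f i : H →L[ℂ] H) (ξ j)⟫_ℂ) (g := fun j => ⟪ξ j, x (ξ j)⟫_ℂ)
    (hξ.mul_left C) (fun j => ?_) (Eventually.of_forall fun i j => ?_)
  · convert! hlim using 2 with i
    · exact (hs (f i)).tsum_eq.symm
    · exact (hs ⟨x, hmem⟩).tsum_eq.symm ▸ rfl
  · have h1 := (Complex.continuous_conj.tendsto _).comp (hB (ξ j) (ξ j))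
    rw [← hx, inner_conj_symm] at h1
    exact h1.congr fun i => inner_conj_symm _ _
  · exact (norm_inner_apply_le _ _).trans (by gcongr; exact hf i)

theorem IsSchwarzMap.norm_le {S : A.Elem →ₗ[ℂ] A.Elem} (hS : IsSchwarzMap S) (x : A.Elem) :
    ‖S x‖ ≤ ‖x‖ := by
  have h1 : star x * x ≤ algebraMap ℝ A.Elem (‖x‖ ^ 2) := CStarAlgebra.star_mul_le_algebraMap_norm_sq
  have h2 : S (algebraMap ℝ A.Elem (‖x‖ ^ 2)) = algebraMap ℝ A.Elem (‖x‖ ^ 2) := by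
    rw [Algebra.algebraMap_eq_smul_one, ← Complex.coe_smul, map_smul, hS.map_one]
  have h3 : star (S x) * S x ≤ algebraMap ℝ A.Elem (‖x‖ ^ 2) :=
    (hS.schwarz x).trans ((hS.mono h1).trans_eq h2)
  have h4 := (CStarAlgebra.norm_le_iff_le_algebraMap _ (by positivity)
    (star_mul_self_nonneg (S x))).2 h3
  rw [CStarRing.norm_star_mul_self, ← sq] at h4
  exact le_of_sq_le_sq h4 (norm_nonneg _)

theorem IsNormalPositive.exists_bound {φ : A.Elem →ₗ[ℂ] ℂ} (hφ : IsNormalPositive φ) :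
    ∃ C, ∀ x, ‖φ x‖ ≤ C * ‖x‖ := by
  obtain ⟨ι, ξ, hξ, hs⟩ := hφ.exists_vectors
  refine ⟨∑' i, ‖ξ i‖ ^ 2, fun x => ?_⟩
  rw [mul_comm, ← (hs x).tsum_eq, ← tsum_mul_left]
  exact tsum_of_norm_bounded (hξ.mul_left _).hasSum fun i => norm_inner_apply_le _ _

theorem IsNormalPositive.tendsto_of_norm {κ : Type*} {L : Filter κ} {φ : A.Elem →ₗ[ℂ] ℂ}
    (hφ : IsNormalPositive φ) {f : κ → A.Elem} (hf : Tendsto f L (𝓝 0)) :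
    Tendsto (fun i => φ (f i)) L (𝓝 0) := by
  obtain ⟨C, hC⟩ := hφ.exists_bound
  refine squeeze_zero_norm (fun i => hC (f i)) ?_
  simpa using hf.norm.const_mul C

/-- The powers `T, T², …`. -/
abbrev positivePowers (T : A.Elem →ₗ[ℂ] A.Elem) : Set (Module.End ℂ A.Elem) :=
  {Φ | ∃ n : ℕ, 1 ≤ n ∧ Φ = (T : Module.End ℂ A.Elem) ^ n}

/-- The Cesàro means of `T, T², …`. -/
noncomputable def cesaro (T : Module.End ℂ A.Elem) (n : ℕ) : Module.End ℂ A.Elem :=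
  ∑ k ∈ Finset.range (n + 1), ((n : ℝ) + 1)⁻¹ • T ^ (k + 1)

theorem cesaro_mem (T : Module.End ℂ A.Elem) (n : ℕ) :
    cesaro T n ∈ convexHull ℝ (positivePowers T) := by
  refine (convex_convexHull ℝ _).sum_mem (fun _ _ => by positivity) ?_
    fun k _ => subset_convexHull ℝ _ ⟨k + 1, by omega, rfl⟩
  rw [Finset.sum_const, Finset.card_range, nsmul_eq_mul]
  push_cast
  exact mul_inv_cancel₀ (by positivity)

theorem map_cesaro (T : Module.End ℂ A.Elem) (n : ℕ) (x : A.Elem) :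
    T (cesaro T n x) = cesaro T n (T x) := by
  simp only [cesaro, LinearMap.sum_apply, LinearMap.smul_apply, map_sum]
  refine Finset.sum_congr rfl fun k _ => ?_
  rw [← Complex.coe_smul, map_smul, ← Module.End.mul_apply, ← pow_succ', pow_succ]
  rfl

/-- The difference telescopes to `(T^(n+2) x - T x) / (n + 1)`, and powers of a Schwarz map are
contractions. -/
theorem tendsto_map_cesaro_sub {T : Module.End ℂ A.Elem} (hT : IsSchwarzMap T) (x : A.Elem) :
    Tendsto (fun n => T (cesaro T n x) - cesaro T n x) atTop (𝓝 0) := by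
  have h : ∀ n, T (cesaro T n x) - cesaro T n x =
      ((n : ℝ) + 1)⁻¹ • ((T ^ (n + 2)) x - T x) := fun n => by
    rw [map_cesaro]
    simp only [cesaro, LinearMap.sum_apply, LinearMap.smul_apply]
    rw [← Finset.sum_sub_distrib]
    have := Finset.sum_range_sub (fun k => (T ^ (k + 1)) x) (n + 1)
    rw [zero_add, pow_one] at this
    rw [← this, Finset.smul_sum]
    refine Finset.sum_congr rfl fun k _ => ?_
    rw [smul_sub, pow_succ T (k + 1)]
    rfl
  refine squeeze_zero_norm (a := fun n : ℕ => (2 * ‖x‖) * (1 / ((n : ℝ) + 1))) (fun n => ?_) ?_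
  · rw [h, norm_smul, norm_inv, Real.norm_of_nonneg (by positivity), mul_comm, one_div]
    gcongr
    refine (norm_sub_le _ _).trans ?_
    linarith [(hT.pow (n + 2)).norm_le x, hT.norm_le x]
  · simpa using (tendsto_one_div_add_atTop_nhds_zero_nat (𝕜 := ℝ)).const_mul (2 * ‖x‖)

theorem convexHull_powers_subset {T : A.Elem →ₗ[ℂ] A.Elem} {C : Set (Module.End ℂ A.Elem)}
    (hC : Convex ℝ C) (h : ∀ n : ℕ, 1 ≤ n → (T : Module.End ℂ A.Elem) ^ n ∈ C) :
    convexHull ℝ (positivePowers T) ⊆ C :=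
  convexHull_min (by rintro _ ⟨n, hn, rfl⟩; exact h n hn) hC

theorem IsSchwarzMap.of_mem_convexHull {T : A.Elem →ₗ[ℂ] A.Elem} (hT : IsSchwarzMap T)
    {S : Module.End ℂ A.Elem} (hS : S ∈ convexHull ℝ (positivePowers T)) : IsSchwarzMap S :=
  convexHull_powers_subset convex_isSchwarzMap (fun n _ => hT.pow n) hS

/-- Applied with `g` the identity (on fixed points), a stationary state, or a normal ergodic
projection. -/
theorem map_eq_of_mem_convexHull {T S : Module.End ℂ A.Elem}
    (hS : S ∈ convexHull ℝ (positivePowers T)) {E : Type*} [AddCommGroup E] [Module ℂ E]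
    (g : A.Elem →ₗ[ℂ] E) {x : A.Elem} (hx : ∀ n : ℕ, g ((T ^ n) x) = g x) : g (S x) = g x := by
  refine convexHull_powers_subset (C := {S | g (S x) = g x}) ?_ (fun n _ => hx n) hS
  intro S hS R hR a b _ _ hab
  simp only [Set.mem_ofPred_eq] at hS hR ⊢
  rw [LinearMap.add_apply, LinearMap.smul_apply, LinearMap.smul_apply, map_add, ← Complex.coe_smul,
    ← Complex.coe_smul, map_smul, map_smul, hS, hR, ← add_smul, ← Complex.ofReal_add, hab,
    Complex.ofReal_one, one_smul]

theorem pow_apply_of_fixed {T : Module.End ℂ A.Elem} {x : A.Elem} (hx : T x = x) (n : ℕ) :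
    (T ^ n) x = x := by
  induction n with
  | zero => rfl
  | succ n ih => rw [pow_succ, Module.End.mul_apply, hx, ih]

/-- A weak⋆ limit of Cesàro means along a free ultrafilter. Normality of `T` is what allows `T` to
be moved through the limit to obtain `T P = P`. -/
theorem exists_isErgodicProjection {T : A.Elem →ₗ[ℂ] A.Elem} (hT : IsMarkovOperator T) :
    ∃ P, IsErgodicProjection T P := by
  have hS := hT.isSchwarzMap
  set U : Ultrafilter ℕ := hyperfilter ℕ
  have hU : (U : Filter ℕ) ≤ atTop := Nat.hyperfilter_le_atTop
  have hbd : ∀ x n, ‖cesaro T n x‖ ≤ ‖x‖ := fun x n =>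
    (hS.of_mem_convexHull (cesaro_mem T n)).norm_le x
  choose P₀ hP₀ using fun x => exists_weakStar_limit U (hbd x)
  let P : A.Elem →ₗ[ℂ] A.Elem :=
    { toFun := P₀
      map_add' x y := elem_ext_normal fun φ hφ => by
        refine tendsto_nhds_unique (hP₀ _ φ hφ) ?_
        rw [map_add]
        exact ((hP₀ x φ hφ).add (hP₀ y φ hφ)).congr fun n => by rw [map_add, map_add]
      map_smul' c x := elem_ext_normal fun φ hφ => by
        refine tendsto_nhds_unique (hP₀ _ φ hφ) ?_
        rw [map_smul]
        exact ((hP₀ x φ hφ).const_smul c).congr fun n => by rw [map_smul, map_smul] }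
  have hP : ∀ x, ∀ φ : A.Elem →ₗ[ℂ] ℂ, IsNormalState φ →
    Tendsto (fun n => φ (cesaro T n x)) U (𝓝 (φ (P x))) := hP₀
  have hzero : ∀ x, ∀ φ : A.Elem →ₗ[ℂ] ℂ, IsNormalState φ →
      Tendsto (fun n => φ (T (cesaro T n x)) - φ (cesaro T n x)) U (𝓝 0) := fun x φ hφ =>
    (((isNormalState_iff.1 hφ).1.tendsto_of_norm (tendsto_map_cesaro_sub hS x)).mono_left
      hU).congr fun n => map_sub _ _ _
  have hTP : ∀ x, T (P x) = P x := fun x => elem_ext_normal fun φ hφ => by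
    have h1 : Tendsto (fun n => φ (T (cesaro T n x))) U (𝓝 (φ (T (P x)))) :=
      hP x (φ ∘ₗ T) (hT.normal φ hφ)
    exact sub_eq_zero.1 (tendsto_nhds_unique (h1.sub (hP x φ hφ)) (hzero x φ hφ))
  refine ⟨P, ?_, LinearMap.ext hTP, LinearMap.ext fun x => elem_ext_normal fun φ hφ => ?_,
    LinearMap.ext fun x => elem_ext_normal fun φ hφ => ?_⟩
  · refine @mem_closure_of_tendsto _ (pointwiseWeakStarTopology A) _ _ _ (fun n => ⇑(cesaro T n)) U _
      (tendsto_pointwiseWeakStar_iff.2 hP) ?_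
    exact Eventually.of_forall fun n => ⟨_, cesaro_mem T n, rfl⟩
  · have h1 : Tendsto (fun n => φ (T (cesaro T n x))) U (𝓝 (φ (P (T x)))) :=
      (hP (T x) φ hφ).congr fun n => by rw [map_cesaro]
    exact sub_eq_zero.1 (tendsto_nhds_unique (h1.sub (hP x φ hφ)) (hzero x φ hφ))
  · refine tendsto_nhds_unique (hP (P x) φ hφ) (tendsto_const_nhds.congr fun n => ?_)
    have := map_eq_of_mem_convexHull (cesaro_mem T n) LinearMap.id
      fun k => pow_apply_of_fixed (T := T) (hTP x) k
    exact congrArg φ this.symm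

/-! ### Properties of ergodic projections -/

namespace IsErgodicProjection

variable {T P : A.Elem →ₗ[ℂ] A.Elem}

theorem exists_ultrafilter (hP : IsErgodicProjection T P) :
    ∃ U : Ultrafilter (Module.End ℂ A.Elem), (∀ᶠ S in (U : Filter _),
      S ∈ convexHull ℝ (positivePowers T)) ∧ ∀ x, ∀ φ : A.Elem →ₗ[ℂ] ℂ, IsNormalState φ →
        Tendsto (fun S : Module.End ℂ A.Elem => φ (S x)) U (𝓝 (φ (P x))) := by
  have h := hP.mem_closure
  rw [@mem_closure_iff_clusterPt _ (pointwiseWeakStarTopology A), ← map_principal] at h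
  obtain ⟨U, hU, h⟩ := (@mapClusterPt_iff_ultrafilter _ _ _ (pointwiseWeakStarTopology A) _ _).1 h
  exact ⟨U, le_principal_iff.1 hU, tendsto_pointwiseWeakStar_iff.1 h⟩

theorem map_idem (hP : IsErgodicProjection T P) (x : A.Elem) : P (P x) = P x :=
  LinearMap.congr_fun hP.idempotent x

theorem apply_mem (hP : IsErgodicProjection T P) (x : A.Elem) : P x ∈ fixedSpace T :=
  LinearMap.congr_fun hP.map_comp x

theorem apply_of_mem (hP : IsErgodicProjection T P) {x : A.Elem} (hx : x ∈ fixedSpace T) :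
    P x = x := by
  obtain ⟨U, hU, h⟩ := hP.exists_ultrafilter
  refine elem_ext_normal fun φ hφ => tendsto_nhds_unique (h x φ hφ)
    (tendsto_const_nhds.congr' ?_)
  filter_upwards [hU] with S hS
  exact congrArg φ (map_eq_of_mem_convexHull hS LinearMap.id
    fun k => pow_apply_of_fixed (T := T) hx k).symm

theorem apply_stationary (hP : IsErgodicProjection T P) {φ : A.Elem →ₗ[ℂ] ℂ}
    (hφ : IsStationaryNormalState T φ) (x : A.Elem) : φ (P x) = φ x := by
  obtain ⟨U, hU, h⟩ := hP.exists_ultrafilter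
  refine tendsto_nhds_unique (h x φ hφ.1) (tendsto_const_nhds.congr' ?_)
  filter_upwards [hU] with S hS
  refine (map_eq_of_mem_convexHull hS φ fun n => ?_).symm
  induction n with
  | zero => rfl
  | succ n ih =>
    rw [pow_succ', Module.End.mul_apply]
    exact (LinearMap.congr_fun hφ.2 _).trans ih

theorem isSchwarzMap (hT : IsSchwarzMap T) (hP : IsErgodicProjection T P) : IsSchwarzMap P := by
  obtain ⟨U, hU, h⟩ := hP.exists_ultrafilter
  refine IsSchwarzMap.of_tendsto (L := (U : Filter _)) (S := fun S => S) ?_ h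
  filter_upwards [hU] with S hS using hT.of_mem_convexHull hS

/-- An ergodic projection absorbs every other ergodic projection if it is normal. -/
theorem unique_of_isNormalMap (hP : IsErgodicProjection T P) (hn : IsNormalMap P)
    {P' : A.Elem →ₗ[ℂ] A.Elem} (hP' : IsErgodicProjection T P') : P' = P := by
  obtain ⟨U, hU, h⟩ := hP'.exists_ultrafilter
  refine LinearMap.ext fun x => elem_ext_normal fun φ hφ => ?_
  -- Since `P' x` is fixed, it equals `P (P' x)`. Normality of `P` makes this the limit of `P (S
  -- x)`, and `P S = P` for every `S` in the convex hull.
  rw [← hP.apply_of_mem (hP'.apply_mem x)]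
  have h1 : Tendsto (fun S : Module.End ℂ A.Elem => φ (P (S x))) U (𝓝 (φ (P (P' x)))) :=
    h x (φ ∘ₗ P) (hn φ hφ)
  refine tendsto_nhds_unique h1 (tendsto_const_nhds.congr' ?_)
  filter_upwards [hU] with S hS
  refine congrArg φ (map_eq_of_mem_convexHull hS P fun n => ?_).symm
  induction n with
  | zero => rfl
  | succ n ih =>
    rw [pow_succ', Module.End.mul_apply]
    exact (LinearMap.congr_fun hP.comp_map _).trans ih

end IsErgodicProjection

end VonNeumannAlgebra

namespace VonNeumannAlgebra

variable {H : Type u} [NormedAddCommGroup H] [InnerProductSpace ℂ H] [CompleteSpace H]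
  {A : VonNeumannAlgebra H}

/-! ### Supports of normal functionals -/

theorem inner_apply_left (x : A.Elem) (u v : H) :
    ⟪(x : H →L[ℂ] H) u, v⟫_ℂ = ⟪u, ((star x : A.Elem) : H →L[ℂ] H) v⟫_ℂ := by
  change _ = ⟪u, (star (x : H →L[ℂ] H)) v⟫_ℂ
  rw [ContinuousLinearMap.star_eq_adjoint, ContinuousLinearMap.adjoint_inner_right]

theorem apply_eq_zero_of_inner_eq_zero {y : A.Elem} (hy : 0 ≤ y) {v : H}
    (h : ⟪v, (y : H →L[ℂ] H) v⟫_ℂ = 0) : (y : H →L[ℂ] H) v = 0 := by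
  obtain ⟨s, rfl⟩ := CStarAlgebra.nonneg_iff_eq_star_mul_self.1 hy
  rw [inner_star_mul_self] at h
  have h1 : (s : H →L[ℂ] H) v = 0 := by simpa using h
  change ((star s : A.Elem) : H →L[ℂ] H) ((s : H →L[ℂ] H) v) = 0
  rw [h1, map_zero]

theorem apply_eq_zero_of_hasSum {φ : A.Elem →ₗ[ℂ] ℂ} {ι : Type*} {ξ : ι → H}
    (h : ∀ x : A.Elem, HasSum (fun i => ⟪ξ i, (x : H →L[ℂ] H) (ξ i)⟫_ℂ) (φ x)) {y : A.Elem}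
    (hy : 0 ≤ y) (h0 : φ y = 0) (i : ι) : (y : H →L[ℂ] H) (ξ i) = 0 := by
  have h1 := h y
  rw [h0, hasSum_zero_iff_of_nonneg fun i => elem_nonneg_iff.1 hy _] at h1
  exact apply_eq_zero_of_inner_eq_zero hy (congrFun h1 i)

theorem rangeSpan_le {S : Set A.Elem} {K : Submodule ℂ H} (hK : IsClosed (K : Set H))
    (h : ∀ p ∈ S, ∀ v, (p : H →L[ℂ] H) v ∈ K) : rangeSpan S ≤ K :=
  Submodule.topologicalClosure_minimal _
    (iSup₂_le fun p hp => by rintro _ ⟨v, rfl⟩; exact h p hp v) hK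

theorem apply_mem_rangeSpan {S : Set A.Elem} {p : A.Elem} (hp : p ∈ S) (v : H) :
    (p : H →L[ℂ] H) v ∈ rangeSpan S :=
  Submodule.le_topologicalClosure _
    ((le_iSup₂_of_le p hp le_rfl : LinearMap.range ((p : H →L[ℂ] H) : H →ₗ[ℂ] H) ≤ _) ⟨v, rfl⟩)

theorem projSup_apply_mem (S : Set A.Elem) (v : H) :
    ((projSup S : A.Elem) : H →L[ℂ] H) v ∈ rangeSpan S :=
  Submodule.starProjection_apply_mem _ _

theorem mul_projSup_eq_zero {S : Set A.Elem} {y : A.Elem} (h : ∀ q ∈ S, y * q = 0) :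
    y * projSup S = 0 := by
  have h1 : rangeSpan S ≤ LinearMap.ker ((y : H →L[ℂ] H) : H →ₗ[ℂ] H) :=
    rangeSpan_le (ContinuousLinearMap.isClosed_ker (y : H →L[ℂ] H)) fun q hq v =>
      congrArg (fun z : A.Elem => (z : H →L[ℂ] H) v) (h q hq)
  exact Subtype.ext (ContinuousLinearMap.ext fun v => h1 (projSup_apply_mem S v))

theorem projSup_apply_eq_zero {S : Set A.Elem} {v : H}
    (h : ∀ q ∈ S, ((star q : A.Elem) : H →L[ℂ] H) v = 0) :
    ((projSup S : A.Elem) : H →L[ℂ] H) v = 0 := by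
  refine (Submodule.starProjection_apply_eq_zero_iff _).2 ?_
  have h1 : rangeSpan S ≤ (ℂ ∙ v)ᗮ := by
    refine rangeSpan_le (Submodule.isClosed_orthogonal _) fun q hq w => ?_
    rw [Submodule.mem_orthogonal_singleton_iff_inner_left, inner_apply_left, h q hq,
      inner_zero_right]
  exact fun w hw => Submodule.mem_orthogonal_singleton_iff_inner_left.1 (h1 hw)

theorem projInf_le {S : Set A.Elem} (hS : ∀ p ∈ S, IsStarProjection p) {q : A.Elem} (hq : q ∈ S) :
    projInf S ≤ q := by
  have h := (isLeast_projSup (S := (fun p : A.Elem => 1 - p) '' S)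
    (by rintro _ ⟨p, hp, rfl⟩; exact (hS p hp).one_sub)).1.2 (1 - q) ⟨q, hq, rfl⟩
  rw [projInf, sub_le_comm]
  exact h

theorem isStarProjection_supportProjection (φ : A.Elem →ₗ[ℂ] ℂ) :
    IsStarProjection (supportProjection φ) :=
  (isStarProjection_projSup _).one_sub

section Support

variable {φ : A.Elem →ₗ[ℂ] ℂ} {ι : Type*} {ξ : ι → H}

/-- If `φ` is carried by `p` then `φ (1 - p) = 0`, so `1 - p` kills every `ξ i`; hence so does the
supremum of these complements. -/
theorem supportProjection_apply
    (h : ∀ x : A.Elem, HasSum (fun i => ⟪ξ i, (x : H →L[ℂ] H) (ξ i)⟫_ℂ) (φ x)) (i : ι) :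
    ((supportProjection φ : A.Elem) : H →L[ℂ] H) (ξ i) = ξ i := by
  set r : A.Elem := projSup ((fun p : A.Elem => 1 - p) '' {p | IsStarProjection p ∧
    ∀ x, φ x = φ (p * x * p)}) with hr
  have h1 : (r : H →L[ℂ] H) (ξ i) = 0 := by
    refine projSup_apply_eq_zero ?_
    rintro _ ⟨p, ⟨hp, hpx⟩, rfl⟩
    rw [hp.one_sub.isSelfAdjoint.star_eq]
    refine apply_eq_zero_of_hasSum h hp.one_sub_nonneg ?_ i
    rw [map_sub, hpx 1, mul_one, hp.isIdempotentElem.eq, sub_self]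
  rw [supportProjection, projInf]
  change ξ i - (r : H →L[ℂ] H) (ξ i) = ξ i
  rw [h1, sub_zero]

theorem supportProjection_le
    (h : ∀ x : A.Elem, HasSum (fun i => ⟪ξ i, (x : H →L[ℂ] H) (ξ i)⟫_ℂ) (φ x)) {q : A.Elem}
    (hq : IsStarProjection q) (hqξ : ∀ i, (q : H →L[ℂ] H) (ξ i) = ξ i) :
    supportProjection φ ≤ q := by
  refine projInf_le (fun p hp => hp.1) ⟨hq, fun x => (h x).unique ?_⟩
  convert! h (q * x * q) using 2 with i
  change _ = ⟪ξ i, (q : H →L[ℂ] H) ((x : H →L[ℂ] H) ((q : H →L[ℂ] H) (ξ i)))⟫_ℂ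
  rw [hqξ]
  nth_rw 1 [← hq.isSelfAdjoint.star_eq]
  rw [← inner_apply_left, hqξ]

/-- As `y` is self-adjoint, the `ξ i` are orthogonal to its range. The complement of the range
projection therefore fixes them and dominates the support. -/
theorem mul_supportProjection_eq_zero
    (h : ∀ x : A.Elem, HasSum (fun i => ⟪ξ i, (x : H →L[ℂ] H) (ξ i)⟫_ℂ) (φ x)) {y : A.Elem}
    (hy : IsSelfAdjoint y) (hyξ : ∀ i, (y : H →L[ℂ] H) (ξ i) = 0) :
    y * supportProjection φ = 0 := by
  set r : A.Elem := projSup {y} with hr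
  have hrp : IsStarProjection r := isStarProjection_projSup _
  have hry : r * y = y := Subtype.ext (ContinuousLinearMap.ext fun v =>
    Submodule.starProjection_eq_self_iff.2 (apply_mem_rangeSpan (Set.mem_singleton y) v))
  have hyr : y * r = y := by
    simpa [hrp.isSelfAdjoint.star_eq, hy.star_eq] using congrArg star hry
  have hle : supportProjection φ ≤ 1 - r := by
    refine supportProjection_le h hrp.one_sub fun i => ?_
    have h1 : (r : H →L[ℂ] H) (ξ i) = 0 := projSup_apply_eq_zero (by
      rintro q rfl
      rw [hy.star_eq]
      exact hyξ i)
    change ξ i - (r : H →L[ℂ] H) (ξ i) = ξ i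
    rw [h1, sub_zero]
  have h2 := ((isStarProjection_supportProjection φ).le_iff_mul_eq_right hrp.one_sub).1 hle
  rw [← h2, ← hyr, mul_assoc, ← mul_assoc r, hrp.mul_one_sub_self, zero_mul, mul_zero]

end Support

/-! ### The maximal positive recurrent projection -/

variable {T : A.Elem →ₗ[ℂ] A.Elem}

theorem isStarProjection_maxPosRec : IsStarProjection (maxPosRec T) :=
  isStarProjection_projSup _

theorem supportProjection_le_maxPosRec {φ : A.Elem →ₗ[ℂ] ℂ} (hφ : IsStationaryNormalState T φ) :
    supportProjection φ ≤ maxPosRec T := by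
  refine (isLeast_projSup fun p hp => hp.1).1.2 _
    ⟨isStarProjection_supportProjection φ, {φ}, by simpa, ?_⟩
  refine (isLeast_projSup ?_).1.2 _ (by simp)
  rintro _ ⟨ψ, -, rfl⟩
  exact isStarProjection_supportProjection ψ

theorem mul_maxPosRec_eq_zero {y : A.Elem}
    (h : ∀ φ, IsStationaryNormalState T φ → y * supportProjection φ = 0) :
    y * maxPosRec T = 0 := by
  refine mul_projSup_eq_zero ?_
  rintro q ⟨hq, F, hF, hle⟩
  rw [hq.le_iff_mul_eq_right (isStarProjection_projSup _)] at hle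
  rw [← hle, ← mul_assoc, mul_projSup_eq_zero, zero_mul]
  rintro _ ⟨φ, hφ, rfl⟩
  exact h φ (hF φ hφ)

/-- Joint faithfulness of the stationary states on the corner of `p_R`: `φ y = 0` with `y ≥ 0`
forces `y` to kill the vectors of `φ`, hence its support. -/
theorem mul_maxPosRec_eq_zero_of_nonneg {y : A.Elem} (hy : 0 ≤ y)
    (h : ∀ φ, IsStationaryNormalState T φ → φ y = 0) : y * maxPosRec T = 0 := by
  refine mul_maxPosRec_eq_zero fun φ hφ => ?_
  obtain ⟨ι, ξ, -, hs⟩ := (isNormalState_iff.1 hφ.1).1.exists_vectors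
  exact mul_supportProjection_eq_zero hs (IsSelfAdjoint.of_nonneg hy)
    (apply_eq_zero_of_hasSum hs hy (h φ hφ))

theorem maxPosRec_apply {φ : A.Elem →ₗ[ℂ] ℂ} (hφ : IsStationaryNormalState T φ) {ι : Type*}
    {ξ : ι → H} (h : ∀ x : A.Elem, HasSum (fun i => ⟪ξ i, (x : H →L[ℂ] H) (ξ i)⟫_ℂ) (φ x)) (i : ι) :
    ((maxPosRec T : A.Elem) : H →L[ℂ] H) (ξ i) = ξ i := by
  have h1 := ((isStarProjection_supportProjection φ).le_iff_mul_eq_right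
    isStarProjection_maxPosRec).1 (supportProjection_le_maxPosRec hφ)
  have h2 := congrArg (fun z : A.Elem => (z : H →L[ℂ] H) (ξ i)) h1
  change ((maxPosRec T : A.Elem) : H →L[ℂ] H)
    (((supportProjection φ : A.Elem) : H →L[ℂ] H) (ξ i)) = _ at h2
  rwa [supportProjection_apply h] at h2

theorem map_maxPosRec_stationary {φ : A.Elem →ₗ[ℂ] ℂ} (hφ : IsStationaryNormalState T φ) :
    φ (maxPosRec T) = φ 1 := by
  obtain ⟨ι, ξ, -, hs⟩ := (isNormalState_iff.1 hφ.1).1.exists_vectors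
  refine (hs _).unique ?_
  simpa only [maxPosRec_apply hφ hs, OneMemClass.coe_one, one_apply_eq_self] using hs 1

/-- A criterion for `p_R ≤ e`: it is enough that `e` fixes all vectors occurring in representations
of stationary states. -/
theorem mul_maxPosRec_eq_self {e : A.Elem} (he : IsStarProjection e)
    (h : ∀ (φ : A.Elem →ₗ[ℂ] ℂ), IsStationaryNormalState T φ → ∀ (ι : Type u) (ξ : ι → H),
      (∀ x : A.Elem, HasSum (fun i => ⟪ξ i, (x : H →L[ℂ] H) (ξ i)⟫_ℂ) (φ x)) →
      ∀ i, (e : H →L[ℂ] H) (ξ i) = ξ i) : e * maxPosRec T = maxPosRec T := by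
  have h1 : (1 - e) * maxPosRec T = 0 := mul_maxPosRec_eq_zero fun φ hφ => by
    obtain ⟨ι, ξ, -, hs⟩ := (isNormalState_iff.1 hφ.1).1.exists_vectors
    have h2 := ((isStarProjection_supportProjection φ).le_iff_mul_eq_right he).1
      (supportProjection_le hs he (h φ hφ ι ξ hs))
    rw [sub_mul, one_mul, h2, sub_self]
  rw [sub_mul, one_mul, sub_eq_zero] at h1
  exact h1.symm

/-- A Schwarz map that preserves the stationary states increases the positive recurrent
projection. -/
theorem IsSchwarzMap.maxPosRec_le {S : A.Elem →ₗ[ℂ] A.Elem} (hS : IsSchwarzMap S)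
    (h : ∀ φ, IsStationaryNormalState T φ → ∀ x, φ (S x) = φ x) : maxPosRec T ≤ S (maxPosRec T) := by
  set p := maxPosRec T with hp
  have hpp : IsStarProjection p := isStarProjection_maxPosRec
  have h0 : 0 ≤ S (1 - p) := hS.nonneg hpp.one_sub_nonneg
  -- Stationary states vanish on `S (1 - p)`, which therefore lives in the corner of `1 - p`; being
  -- at most `1`, it is at most `1 - p`.
  have h1 : S (1 - p) * p = 0 := mul_maxPosRec_eq_zero_of_nonneg h0 fun φ hφ => by
    rw [h φ hφ, map_sub, map_maxPosRec_stationary hφ, sub_self]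
  have h2 : S (1 - p) = star (1 - p) * S (1 - p) * (1 - p) := by
    have h3 : p * S (1 - p) = 0 := by
      have h4 := congrArg star h1
      rwa [star_mul, star_zero, hpp.isSelfAdjoint.star_eq,
        (IsSelfAdjoint.of_nonneg h0).star_eq] at h4
    rw [hpp.one_sub.isSelfAdjoint.star_eq]
    simp only [sub_mul, mul_sub, one_mul, mul_one, h1, h3, sub_zero]
  have h4 : S (1 - p) ≤ 1 - p := by
    have h5 : S (1 - p) ≤ 1 := (hS.mono hpp.one_sub.le_one).trans_eq hS.map_one
    have h6 := star_left_conjugate_le_conjugate h5 (1 - p)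
    rw [← h2, mul_one, hpp.one_sub.isSelfAdjoint.star_eq, hpp.one_sub.isIdempotentElem.eq] at h6
    exact h6
  rw [map_sub, hS.map_one] at h4
  exact (sub_le_sub_iff_left 1).1 h4

end VonNeumannAlgebra

namespace VonNeumannAlgebra

variable {H : Type u} [NormedAddCommGroup H] [InnerProductSpace ℂ H] [CompleteSpace H]
  {A : VonNeumannAlgebra H} {T P : A.Elem →ₗ[ℂ] A.Elem}

/-! ### The Choi–Effros product -/

theorem elem_eq_zero {x : A.Elem} (h : ∀ v : H, vectorForm v v x = 0) : x = 0 := by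
  refine elem_ext fun u v => ?_
  simp only [vectorForm_eq u v, LinearMap.smul_apply, LinearMap.add_apply, LinearMap.sub_apply, h,
    map_zero, smul_zero, sub_zero, add_zero]

theorem eq_zero_of_map_star_mul_self {ω : A.Elem →ₗ[ℂ] ℂ} (hω : ∀ x, 0 ≤ x → 0 ≤ ω x) {a : A.Elem}
    (ha : ω (star a * a) = 0) (b : A.Elem) : ω (star a * b) = 0 := by
  set f : A.Elem →ₚ[ℂ] ℂ := PositiveLinearMap.mk₀ ω hω
  have h1 : f.toGNS a = 0 := by
    rw [← inner_self_eq_zero (𝕜 := ℂ), f.inner_toGNS]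
    exact ha
  have h2 : ω (star a * b) = ⟪f.toGNS a, f.toGNS b⟫_ℂ := (f.inner_toGNS a b).symm
  rw [h2, h1, inner_zero_left]

theorem vectorForm_self_nonneg {x : A.Elem} (hx : 0 ≤ x) (v : H) : 0 ≤ vectorForm v v x :=
  elem_nonneg_iff.1 hx v

theorem IsSchwarzMap.map_star_mul_eq_zero (hP : IsSchwarzMap P) {a : A.Elem}
    (ha : P (star a * a) = 0) (b : A.Elem) : P (star a * b) = 0 :=
  elem_eq_zero fun v => eq_zero_of_map_star_mul_self (ω := vectorForm v v ∘ₗ P)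
    (fun _ hx => vectorForm_self_nonneg (hP.nonneg hx) v) (by rw [LinearMap.comp_apply, ha, map_zero]) b

/-- The Choi–Effros identity for an idempotent Schwarz map. -/
theorem IsSchwarzMap.map_star_mul_map (hP : IsSchwarzMap P) (hPP : ∀ x, P (P x) = P x) {b : A.Elem}
    (hb : P b = b) (a : A.Elem) : P (star b * P a) = P (star b * a) := by
  rw [eq_comm, ← sub_eq_zero]
  refine elem_eq_zero fun v => ?_
  -- The Schwarz defect as a sesquilinear form: positive because `P` is Schwarz, positive and
  -- idempotent. Since `P b = b`, the vector `b` is null for it, and Cauchy–Schwarz kills the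
  -- pairing of `b` with `a`.
  let c : PreInnerProductSpace.Core ℂ A.Elem :=
    { inner x y := vectorForm v v (P (star x * y)) - vectorForm v v (P (star (P x) * P y))
      conj_inner_symm x y := by
        have h : ∀ z : A.Elem, starRingEnd ℂ (vectorForm v v z) = vectorForm v v (star z) :=
          fun z => by rw [vectorForm_apply, inner_conj_symm, inner_apply_left]; rfl
        rw [map_sub, h, h, ← hP.map_star, ← hP.map_star, star_mul, star_mul, star_star, star_star]
      re_inner_nonneg x := by
        rw [← map_sub, ← hPP (star x * x), ← map_sub]
        exact (Complex.nonneg_iff.1 (vectorForm_self_nonneg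
          (hP.nonneg (sub_nonneg.2 (hP.schwarz x))) v)).1
      add_left x y z := by
        simp only [map_add, star_add, add_mul]
        ring
      smul_left x y r := by
        simp only [map_smul, star_smul, smul_mul_assoc, smul_eq_mul, mul_sub]
        rfl }
  have h1 : c.inner b b = 0 := by
    change vectorForm v v (P (star b * b)) - vectorForm v v (P (star (P b) * P b)) = 0
    rw [hb, sub_self]
  have h2 := @InnerProductSpace.Core.inner_mul_inner_self_le ℂ A.Elem _ _ _ c b a
  have h3 : ‖c.inner b a‖ * ‖c.inner a b‖ ≤ RCLike.re (c.inner b b) * RCLike.re (c.inner a a) := h2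
  have h4 : ‖c.inner a b‖ = ‖c.inner b a‖ := by
    rw [← c.conj_inner_symm a b, RCLike.norm_conj]
  rw [h1, h4, map_zero, zero_mul, ← sq] at h3
  have h5 : c.inner b a = 0 := by
    simpa using le_antisymm h3 (sq_nonneg _)
  rw [map_sub]
  have h6 : vectorForm v v (P (star b * a)) - vectorForm v v (P (star (P b) * P a)) = 0 := h5
  rwa [hb] at h6

theorem mem_fixedSpace {x : A.Elem} : x ∈ fixedSpace T ↔ T x = x := Iff.rfl

theorem star_mem_fixedSpace (hT : IsSchwarzMap T) {x : A.Elem} (hx : x ∈ fixedSpace T) :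
    star x ∈ fixedSpace T := by
  rw [mem_fixedSpace] at hx ⊢
  rw [hT.map_star, hx]

namespace IsErgodicProjection

variable (hT : IsSchwarzMap T) (hP : IsErgodicProjection T P)

include hT hP

theorem map_mul_map {b : A.Elem} (hb : b ∈ fixedSpace T) (a : A.Elem) :
    P (b * P a) = P (b * a) := by
  simpa using (hP.isSchwarzMap hT).map_star_mul_map hP.map_idem
    (hP.apply_of_mem (star_mem_fixedSpace hT hb)) a

/-- In the corner of `p_R`, the Choi–Effros product of fixed points is their product. -/
theorem map_star_mul_mul_maxPosRec {y z : A.Elem} (hy : y ∈ fixedSpace T)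
    (hz : z ∈ fixedSpace T) : P (star y * z) * maxPosRec T = star y * z * maxPosRec T := by
  -- On the diagonal the defect is positive and annihilated by stationary states. The general case
  -- follows by polarization with `y + z` and `y + i z`.
  have hD : ∀ w ∈ fixedSpace T, (P (star w * w) - star w * w) * maxPosRec T = 0 := fun w hw => by
    refine mul_maxPosRec_eq_zero_of_nonneg ?_ fun φ hφ => ?_
    · have h1 := (hP.isSchwarzMap hT).schwarz w
      rw [hP.apply_of_mem hw] at h1
      exact sub_nonneg.2 h1
    · rw [map_sub, hP.apply_stationary hφ, sub_self]
  have h1 := hD _ hy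
  have h2 := hD _ hz
  have h3 := hD _ (add_mem hy hz)
  have h4 := hD _ (add_mem hy (Submodule.smul_mem _ Complex.I hz))
  simp only [star_add, star_smul, add_mul, mul_add, smul_mul_assoc, mul_smul_comm, map_add,
    map_smul, map_neg, sub_mul, Complex.star_def, Complex.conj_I, smul_add, smul_neg, smul_smul,
    neg_smul, neg_mul, Complex.I_mul_I, neg_neg, one_smul] at h1 h2 h3 h4
  have h5 : (P (star y * z) * maxPosRec T - star y * z * maxPosRec T) +
      (P (star z * y) * maxPosRec T - star z * y * maxPosRec T) = 0 := by
    linear_combination (norm := module) h3 - h1 - h2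
  have h6 : Complex.I • ((P (star y * z) * maxPosRec T - star y * z * maxPosRec T) -
      (P (star z * y) * maxPosRec T - star z * y * maxPosRec T)) = 0 := by
    linear_combination (norm := module) h4 - h1 - h2
  rw [smul_eq_zero_iff_right Complex.I_ne_zero] at h6
  have h7 : (2 : ℂ) • (P (star y * z) * maxPosRec T - star y * z * maxPosRec T) = 0 := by
    linear_combination (norm := module) h5 + h6
  rw [smul_eq_zero_iff_right two_ne_zero] at h7
  exact sub_eq_zero.1 h7

variable (hp : P (maxPosRec T) = 1)

include hp

/-- Here `P (1 - p_R) = 0`, and Cauchy–Schwarz for the positive map `P` propagates this to the whole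
right ideal. -/
theorem map_one_sub_mul (z : A.Elem) : P ((1 - maxPosRec T) * z) = 0 := by
  have hq : IsStarProjection (1 - maxPosRec T) := isStarProjection_maxPosRec.one_sub
  have h := (hP.isSchwarzMap hT).map_star_mul_eq_zero (a := 1 - maxPosRec T)
    (by rw [hq.isSelfAdjoint.star_eq, hq.isIdempotentElem.eq, map_sub, hp,
      (hP.isSchwarzMap hT).map_one, sub_self]) z
  rwa [hq.isSelfAdjoint.star_eq] at h

theorem map_mul_one_sub (z : A.Elem) : P (z * (1 - maxPosRec T)) = 0 := by
  have hq : IsStarProjection (1 - maxPosRec T) := isStarProjection_maxPosRec.one_sub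
  have h := congrArg star (hP.map_one_sub_mul hT hp (star z))
  rwa [← (hP.isSchwarzMap hT).map_star, star_mul, star_star, hq.isSelfAdjoint.star_eq,
    star_zero] at h

theorem map_compression (z : A.Elem) : P (compression (maxPosRec T) z) = P z := by
  have h1 := hP.map_one_sub_mul hT hp z
  have h2 := hP.map_mul_one_sub hT hp (maxPosRec T * z)
  rw [sub_mul, one_mul, map_sub, sub_eq_zero] at h1
  rw [mul_sub, mul_one, map_sub, sub_eq_zero] at h2
  rw [compression_apply, ← h2, ← h1]

theorem map_compression_of_mem {y : A.Elem} (hy : y ∈ fixedSpace T) :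
    P (compression (maxPosRec T) y) = y := by
  rw [hP.map_compression hT hp, hP.apply_of_mem hy]

/-- With `q = 1 - p_R` and `a = (q y p_R)⋆ (q y p_R)`, the Choi–Effros identity gives `P a = P (y⋆ P
(q y)) = 0`. Stationary states then vanish on `a`, which lies in the corner of `p_R`, so `a = 0`. -/
theorem one_sub_mul_mul_maxPosRec {y : A.Elem} (hy : y ∈ fixedSpace T) :
    (1 - maxPosRec T) * y * maxPosRec T = 0 := by
  set p := maxPosRec T with hpdef
  have hpp : IsStarProjection p := isStarProjection_maxPosRec
  rw [← CStarRing.star_mul_self_eq_zero_iff]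
  set a := star ((1 - p) * y * p) * ((1 - p) * y * p) with ha
  have h0 : a = compression p (star y * ((1 - p) * y)) := by
    rw [ha, compression_apply, star_mul, star_mul, hpp.isSelfAdjoint.star_eq,
      hpp.one_sub.isSelfAdjoint.star_eq]
    calc p * (star y * (1 - p)) * ((1 - p) * y * p)
        = p * (star y * (((1 - p) * (1 - p)) * y)) * p := by simp only [mul_assoc]
      _ = _ := by rw [hpp.one_sub.isIdempotentElem.eq]
  have h1 : P a = 0 := by
    rw [h0, hP.map_compression hT hp, ← hP.map_mul_map hT (star_mem_fixedSpace hT hy),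
      hP.map_one_sub_mul hT hp, mul_zero, map_zero]
  have h2 : a * p = 0 := mul_maxPosRec_eq_zero_of_nonneg (star_mul_self_nonneg _) fun φ hφ => by
    rw [← hP.apply_stationary hφ, h1, map_zero]
  rw [← h2, h0, compression_apply, mul_assoc _ p p, hpp.isIdempotentElem.eq]

theorem commute_maxPosRec {y : A.Elem} (hy : y ∈ fixedSpace T) : Commute (maxPosRec T) y := by
  have hpp : IsStarProjection (maxPosRec T) := isStarProjection_maxPosRec
  have h1 := hP.one_sub_mul_mul_maxPosRec hT hp hy
  have h2 := congrArg star (hP.one_sub_mul_mul_maxPosRec hT hp (star_mem_fixedSpace hT hy))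
  rw [star_mul, star_mul, star_star, hpp.isSelfAdjoint.star_eq,
    hpp.one_sub.isSelfAdjoint.star_eq, star_zero, mul_sub, mul_sub, mul_one, sub_eq_zero] at h2
  rw [sub_mul, sub_mul, one_mul, sub_eq_zero] at h1
  rw [Commute, SemiconjBy, h2, ← mul_assoc]
  exact h1.symm

theorem compression_add {y : A.Elem} (hy : y ∈ fixedSpace T) :
    compression (maxPosRec T) y + (1 - maxPosRec T) * y * (1 - maxPosRec T) = y := by
  have hpp : IsStarProjection (maxPosRec T) := isStarProjection_maxPosRec
  have h1 := (hP.commute_maxPosRec hT hp hy).eq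
  have h2 : maxPosRec T * y * maxPosRec T = y * maxPosRec T := by
    rw [h1, mul_assoc, hpp.isIdempotentElem.eq]
  rw [compression_apply, mul_sub, mul_one, sub_mul, sub_mul, one_mul, h2, h1]
  abel

theorem isStarIsomorphism :
    IsStarIsomorphism (recurrentFixedSpace T) (fixedSpace T) (choiEffrosMul P) P where
  mul_mem := by
    rintro _ ⟨y, hy, rfl⟩ _ ⟨z, hz, rfl⟩
    have hpp : IsStarProjection (maxPosRec T) := isStarProjection_maxPosRec
    -- The Choi–Effros product of the two fixed points compresses to the product of their
    -- compressions.
    refine ⟨P (y * z), hP.apply_mem _, ?_⟩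
    have h1 := hP.map_star_mul_mul_maxPosRec hT (star_mem_fixedSpace hT hy) hz
    have h2 := (hP.commute_maxPosRec hT hp hy).eq
    have h3 := (hP.commute_maxPosRec hT hp hz).eq
    rw [star_star] at h1
    rw [compression_apply, compression_apply, compression_apply, mul_assoc, h1]
    calc maxPosRec T * (y * z * maxPosRec T) = maxPosRec T * y * (z * maxPosRec T) := by
          simp only [mul_assoc]
      _ = maxPosRec T * y * (maxPosRec T * (maxPosRec T * z * maxPosRec T)) := by
          rw [← mul_assoc (maxPosRec T), ← mul_assoc (maxPosRec T), hpp.isIdempotentElem.eq, h3,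
            mul_assoc z, hpp.isIdempotentElem.eq]
      _ = _ := by simp only [mul_assoc]
  star_mem := by
    rintro _ ⟨y, hy, rfl⟩
    refine ⟨star y, star_mem_fixedSpace hT hy, ?_⟩
    rw [compression_apply, compression_apply, star_mul, star_mul,
      isStarProjection_maxPosRec.isSelfAdjoint.star_eq, mul_assoc]
  bijOn := by
    refine ⟨fun x _ => hP.apply_mem x, ?_, fun y hy => ?_⟩
    · rintro _ ⟨y, hy, rfl⟩ _ ⟨z, hz, rfl⟩ h
      rw [hP.map_compression_of_mem hT hp hy, hP.map_compression_of_mem hT hp hz] at h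
      rw [h]
    · exact ⟨_, ⟨y, hy, rfl⟩, hP.map_compression_of_mem hT hp hy⟩
  map_mul := by
    rintro _ ⟨y, hy, rfl⟩ _ ⟨z, hz, rfl⟩
    have hpp : IsStarProjection (maxPosRec T) := isStarProjection_maxPosRec
    have h3 := (hP.commute_maxPosRec hT hp hz).eq
    rw [hP.map_compression_of_mem hT hp hy, hP.map_compression_of_mem hT hp hz, choiEffrosMul,
      ← hP.map_compression hT hp (y * z)]
    congr 1
    simp only [compression_apply]
    calc maxPosRec T * y * maxPosRec T * (maxPosRec T * z * maxPosRec T)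
        = maxPosRec T * y * ((maxPosRec T * maxPosRec T) * z * maxPosRec T) := by
          simp only [mul_assoc]
      _ = _ := by
          rw [hpp.isIdempotentElem.eq, h3, mul_assoc z, hpp.isIdempotentElem.eq]
          simp only [mul_assoc]
  map_star x _ := (hP.isSchwarzMap hT).map_star x

end IsErgodicProjection

end VonNeumannAlgebra

namespace VonNeumannAlgebra

variable {H : Type u} [NormedAddCommGroup H] [InnerProductSpace ℂ H] [CompleteSpace H]
  {A : VonNeumannAlgebra H} {T P : A.Elem →ₗ[ℂ] A.Elem}

/-! ### Normality of ergodic projections -/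

theorem vectorForm_star_mul_self (x : A.Elem) (v : H) :
    vectorForm v v (star x * x) = ((‖(x : H →L[ℂ] H) v‖ ^ 2 : ℝ) : ℂ) := by
  rw [vectorForm_apply, inner_star_mul_self, Complex.ofReal_pow]

theorem IsNormalPositive.of_le_hasSum {κ : Type*} {φ : A.Elem →ₗ[ℂ] ℂ}
    {χ : κ → A.Elem →ₗ[ℂ] ℂ} (hχ : ∀ k, IsNormalPositive (χ k))
    (hs : ∀ x, Summable fun k => χ k x) (h0 : ∀ x, 0 ≤ x → 0 ≤ φ x)
    (h : ∀ x, 0 ≤ x → φ x ≤ ∑' k, χ k x) : IsNormalPositive φ := by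
  let ψ : A.Elem →ₗ[ℂ] ℂ :=
    { toFun x := ∑' k, χ k x
      map_add' x y := by simp only [map_add]; exact (hs x).tsum_add (hs y)
      map_smul' c x := by simp only [map_smul, smul_eq_mul]; exact tsum_mul_left }
  have hψ : IsNormalPositive ψ := .hasSum hχ fun x => (hs x).hasSum
  exact hψ.of_le h0 h

theorem IsNormalPositive.hasSum_of_nonneg {κ : Type*} {χ : κ → A.Elem →ₗ[ℂ] ℂ}
    {ψ : A.Elem →ₗ[ℂ] ℂ} (hχ : ∀ k, IsNormalPositive (χ k))
    (h : ∀ x, 0 ≤ x → HasSum (fun k => χ k x) (ψ x)) : IsNormalPositive ψ := by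
  refine .hasSum hχ fun x => ?_
  have hx : x ∈ Submodule.span ℂ {a : A.Elem | 0 ≤ a} := by
    rw [CStarAlgebra.span_nonneg]
    trivial
  induction hx using Submodule.span_induction with
  | mem x hx => exact h x hx
  | zero => simp
  | add x y _ _ hx hy => simpa using hx.add hy
  | smul c x _ hx => simpa using hx.mul_left c

/-- Cauchy–Schwarz with weights `2^i`, whose inverses sum to at most `2`. It bounds the vector
functional of a series by a weighted series of vector functionals. -/
theorem norm_sum_sq_le (w : ℕ → H) (n : ℕ) :
    ‖∑ i ∈ Finset.range n, w i‖ ^ 2 ≤ 2 * ∑ i ∈ Finset.range n, 2 ^ i * ‖w i‖ ^ 2 := by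
  calc ‖∑ i ∈ Finset.range n, w i‖ ^ 2 ≤ (∑ i ∈ Finset.range n, ‖w i‖) ^ 2 := by
        gcongr; exact norm_sum_le _ _
    _ ≤ (∑ i ∈ Finset.range n, (1 / 2 : ℝ) ^ i) * ∑ i ∈ Finset.range n, 2 ^ i * ‖w i‖ ^ 2 := by
        refine Finset.sum_sq_le_sum_mul_sum_of_sq_le_mul _ (fun _ _ => by positivity)
          (fun _ _ => by positivity) fun i _ => ?_
        rw [← mul_assoc, ← mul_pow]
        norm_num
    _ ≤ _ := by
        gcongr
        exact sum_geometric_two_le n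

namespace IsSchwarzMap

variable (hP : IsSchwarzMap P)

include hP

theorem isNormalPositive_comp_of_le {u : H} {ψ : A.Elem →ₗ[ℂ] ℂ} (hψ : IsNormalPositive ψ)
    (h : ∀ x, 0 ≤ x → vectorForm u u (P x) ≤ ψ x) :
    IsNormalPositive (vectorForm u u ∘ₗ P) :=
  hψ.of_le (fun _ hx => vectorForm_self_nonneg (hP.nonneg hx) u) h

/-- Write `u = ∑ v n` with `v n ∈ K` decaying geometrically. The functional of `u` is dominated by
`∑ 2 · 2^n` times that of `v n`, which is normal. -/
theorem isNormalPositive_comp_of_mem_closure (K : AddSubgroup H)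
    (hK : ∀ v ∈ K, IsNormalPositive (vectorForm v v ∘ₗ P)) {u : H}
    (hu : u ∈ closure (K : Set H)) : IsNormalPositive (vectorForm u u ∘ₗ P) := by
  obtain ⟨v, hv, hvK, -, hvb⟩ := controlled_sum_of_mem_closure hu (b := fun n => (1 / 2 : ℝ) ^ n)
    fun n => by positivity
  have hms : Summable fun n => 2 * (2 ^ n * ‖v n‖ ^ 2) := by
    refine Summable.mul_left _ ?_
    -- The decay estimate is available only for `n > 0`; the first term is dropped.
    rw [← summable_nat_add_iff 1]
    refine Summable.of_nonneg_of_le (fun n => by positivity) (fun n => ?_)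
      ((summable_nat_add_iff 1).2 (summable_geometric_two))
    calc 2 ^ (n + 1) * ‖v (n + 1)‖ ^ 2 ≤ 2 ^ (n + 1) * ((1 / 2 : ℝ) ^ (n + 1)) ^ 2 := by
          gcongr
          exact (hvb _ (Nat.succ_pos n)).le
      _ = (1 / 2 : ℝ) ^ (n + 1) := by
          rw [sq, ← mul_assoc, ← mul_pow]
          norm_num
  refine .of_le_hasSum (χ := fun n => ((2 * 2 ^ n : ℝ) : ℂ) • (vectorForm (v n) (v n) ∘ₗ P))
    (fun n => (hK _ (hvK n)).smul (by positivity)) (fun x => ?_)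
    (fun x hx => vectorForm_self_nonneg (hP.nonneg hx) u) fun x hx => ?_
  · refine Summable.of_norm_bounded (hms.mul_left ‖(P x : H →L[ℂ] H)‖) fun n => ?_
    rw [LinearMap.smul_apply, smul_eq_mul, norm_mul, Complex.norm_of_nonneg (by positivity)]
    calc 2 * 2 ^ n * ‖vectorForm (v n) (v n) (P x)‖
        ≤ 2 * 2 ^ n * (‖(P x : H →L[ℂ] H)‖ * ‖v n‖ ^ 2) := by
          gcongr; exact norm_inner_apply_le _ _
      _ = _ := by ring
  · obtain ⟨s, hs⟩ := CStarAlgebra.nonneg_iff_eq_star_mul_self.1 (hP.nonneg hx)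
    simp only [LinearMap.smul_apply, LinearMap.comp_apply, hs, vectorForm_star_mul_self, smul_eq_mul,
      ← Complex.ofReal_mul, ← Complex.ofReal_tsum]
    rw [Complex.real_le_real]
    have hss : Summable fun n => 2 * 2 ^ n * ‖(s : H →L[ℂ] H) (v n)‖ ^ 2 := by
      refine Summable.of_nonneg_of_le (fun n => by positivity) (fun n => ?_)
        (hms.mul_left (‖(s : H →L[ℂ] H)‖ ^ 2))
      calc 2 * 2 ^ n * ‖(s : H →L[ℂ] H) (v n)‖ ^ 2
          ≤ 2 * 2 ^ n * (‖(s : H →L[ℂ] H)‖ * ‖v n‖) ^ 2 := by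
            gcongr; exact (s : H →L[ℂ] H).le_opNorm _
        _ = _ := by ring
    have hlim := ((((s : H →L[ℂ] H).continuous.tendsto u).comp hv).norm).pow 2
    refine le_of_tendsto hlim (Eventually.of_forall fun n => ?_)
    simp only [Function.comp, map_sum]
    refine (norm_sum_sq_le _ _).trans ?_
    rw [Finset.mul_sum]
    simp only [← mul_assoc]
    exact hss.sum_le_tsum _ fun n _ => by positivity

/-- The vectors whose vector functional stays normal under composition with `P`. -/
def normalVectors (P : A.Elem →ₗ[ℂ] A.Elem) (hP : IsSchwarzMap P) : Submodule ℂ H where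
  carrier := {v | IsNormalPositive (vectorForm v v ∘ₗ P)}
  zero_mem' := by
    refine hP.isNormalPositive_comp_of_le (isNormalPositive_vectorForm 0) fun x _ => ?_
    simp
  add_mem' {u v} hu hv := by
    refine hP.isNormalPositive_comp_of_le ((hu.add hv).smul (c := 2) (by norm_num)) fun x hx => ?_
    obtain ⟨s, hs⟩ := CStarAlgebra.nonneg_iff_eq_star_mul_self.1 (hP.nonneg hx)
    simp only [LinearMap.smul_apply, LinearMap.add_apply, LinearMap.comp_apply, hs,
      vectorForm_star_mul_self, smul_eq_mul, ← Complex.ofReal_mul, ← Complex.ofReal_add]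
    rw [Complex.real_le_real, map_add]
    have h1 := norm_add_le ((s : H →L[ℂ] H) u) ((s : H →L[ℂ] H) v)
    nlinarith [norm_nonneg ((s : H →L[ℂ] H) u + (s : H →L[ℂ] H) v),
      sq_nonneg (‖(s : H →L[ℂ] H) u‖ - ‖(s : H →L[ℂ] H) v‖)]
  smul_mem' c v hv := by
    refine hP.isNormalPositive_comp_of_le (hv.smul (c := ‖c‖ ^ 2) (by positivity)) fun x hx => ?_
    obtain ⟨s, hs⟩ := CStarAlgebra.nonneg_iff_eq_star_mul_self.1 (hP.nonneg hx)
    simp only [LinearMap.smul_apply, LinearMap.comp_apply, hs,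
      vectorForm_star_mul_self, smul_eq_mul, ← Complex.ofReal_mul]
    rw [Complex.real_le_real, map_smul, norm_smul, mul_pow]

omit hP in
theorem mem_normalVectors {hP : IsSchwarzMap P} {v : H} :
    v ∈ normalVectors P hP ↔ IsNormalPositive (vectorForm v v ∘ₗ P) := Iff.rfl

theorem isClosed_normalVectors : IsClosed (normalVectors P hP : Set H) := by
  rw [← closure_subset_iff_isClosed]
  exact fun u hu => hP.isNormalPositive_comp_of_mem_closure (normalVectors P hP).toAddSubgroup
    (fun v hv => hv) hu

/-- The factor `s` of `P x = s⋆ s` lies in `A` and commutes with `y`, so the functional of `y v` is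
at most `‖y‖²` times that of `v`. Invariance under the commutant puts the projection onto the normal
vectors in `A`. -/
theorem apply_mem_normalVectors {y : H →L[ℂ] H} (hy : y ∈ A.commutant) {v : H}
    (hv : v ∈ normalVectors P hP) : y v ∈ normalVectors P hP := by
  refine hP.isNormalPositive_comp_of_le (IsNormalPositive.smul hv (c := ‖y‖ ^ 2) (by positivity))
    fun x hx => ?_
  obtain ⟨s, hs⟩ := CStarAlgebra.nonneg_iff_eq_star_mul_self.1 (hP.nonneg hx)
  simp only [LinearMap.smul_apply, LinearMap.comp_apply, hs,
    vectorForm_star_mul_self, smul_eq_mul, ← Complex.ofReal_mul]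
  rw [Complex.real_le_real, ← mul_pow]
  have h1 : (s : H →L[ℂ] H) (y v) = y ((s : H →L[ℂ] H) v) :=
    congrArg (fun z : H →L[ℂ] H => z v) (mem_commutant_iff.1 hy _ s.2)
  rw [h1]
  gcongr
  exact y.le_opNorm _

/-- If `φ` is stationary with vectors `ξ i`, then `⟨ξ i, P(x) ξ i⟩ ≤ φ (P x) = φ x` for `x ≥ 0`. By
domination each `ξ i` is a normal vector. -/
theorem maxPosRec_apply_mem_normalVectors
    (hφ : ∀ φ, IsStationaryNormalState T φ → ∀ x, φ (P x) = φ x) (v : H) :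
    ((maxPosRec T : A.Elem) : H →L[ℂ] H) v ∈ normalVectors P hP := by
  have hc : CompleteSpace (normalVectors P hP) := hP.isClosed_normalVectors.completeSpace_coe
  have hmem : (normalVectors P hP).starProjection ∈ A := by
    rw [IsStarProjection.mem_iff isStarProjection_starProjection]
    intro y hy
    rw [Submodule.range_starProjection, Module.End.mem_invtSubmodule]
    exact fun v hv => hP.apply_mem_normalVectors hy hv
  have hsp : IsStarProjection (normalVectors P hP).starProjection := isStarProjection_starProjection
  have h1 := mul_maxPosRec_eq_self (T := T) (e := ⟨(normalVectors P hP).starProjection, hmem⟩)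
    ⟨Subtype.ext hsp.isIdempotentElem, Subtype.ext hsp.isSelfAdjoint⟩ fun φ hst ι ξ h i => by
      refine Submodule.starProjection_eq_self_iff.2 ?_
      refine hP.isNormalPositive_comp_of_le (isNormalState_iff.1 hst.1).1 fun x hx => ?_
      rw [← hφ φ hst]
      exact le_hasSum (h (P x)) i fun j _ => elem_nonneg_iff.1 (hP.nonneg hx) _
  have h2 := congrArg (fun z : A.Elem => (z : H →L[ℂ] H) v) h1
  exact Submodule.starProjection_eq_self_iff.1 h2

theorem isNormalPositive_comp_compression
    (hφ : ∀ φ, IsStationaryNormalState T φ → ∀ x, φ (P x) = φ x) {φ : A.Elem →ₗ[ℂ] ℂ}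
    (hn : IsNormalPositive φ) : IsNormalPositive (φ ∘ₗ compression (maxPosRec T) ∘ₗ P) := by
  obtain ⟨ι, ξ, -, h⟩ := hn.exists_vectors
  refine .hasSum (fun i => mem_normalVectors.1
    (hP.maxPosRec_apply_mem_normalVectors hφ (ξ i))) fun x => ?_
  change HasSum _ (φ (compression (maxPosRec T) (P x)))
  convert! h (compression (maxPosRec T) (P x)) using 2 with i
  rw [LinearMap.comp_apply, vectorForm_apply, inner_apply_left,
    isStarProjection_maxPosRec.isSelfAdjoint.star_eq]
  rfl

end IsSchwarzMap

end VonNeumannAlgebra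

namespace VonNeumannAlgebra

variable {H : Type u} [NormedAddCommGroup H] [InnerProductSpace ℂ H] [CompleteSpace H]
  {A : VonNeumannAlgebra H} {T P : A.Elem →ₗ[ℂ] A.Elem}

/-! ### Powers of `T` on `p_R` and normality of `P` -/

theorem IsSchwarzMap.monotone_pow_apply (hT : IsSchwarzMap T) {x : A.Elem} (hx : x ≤ T x) :
    Monotone fun n => ((T : Module.End ℂ A.Elem) ^ n) x :=
  monotone_nat_of_le_succ fun n => by
    rw [pow_succ, Module.End.mul_apply]
    exact (hT.pow n).mono hx

/-- As `T^n x` increases, a convex combination of powers is bounded by the largest one occurring.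
This turns approximation by the convex hull into convergence of the powers themselves. -/
theorem IsSchwarzMap.exists_le_pow_apply (hT : IsSchwarzMap T) {x : A.Elem} (hx : x ≤ T x)
    {S : Module.End ℂ A.Elem} (hS : S ∈ convexHull ℝ (positivePowers T)) :
    ∃ n, S x ≤ ((T : Module.End ℂ A.Elem) ^ n) x := by
  refine convexHull_powers_subset
    (C := {S : Module.End ℂ A.Elem | ∃ n, S x ≤ ((T : Module.End ℂ A.Elem) ^ n) x}) ?_
    (fun n _ => ⟨n, le_rfl⟩) hS
  rintro S ⟨m, hm⟩ R ⟨n, hn⟩ a b ha hb hab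
  refine ⟨max m n, ?_⟩
  have hm' := hm.trans (hT.monotone_pow_apply hx (le_max_left m n))
  have hn' := hn.trans (hT.monotone_pow_apply hx (le_max_right m n))
  rw [LinearMap.add_apply, LinearMap.smul_apply, LinearMap.smul_apply]
  refine (add_le_add (smul_le_smul_of_nonneg_left hm' ha)
    (smul_le_smul_of_nonneg_left hn' hb)).trans_eq ?_
  rw [← add_smul, hab, one_smul]

theorem stationary_apply (φ : A.Elem →ₗ[ℂ] ℂ) (hφ : IsStationaryNormalState T φ) (x : A.Elem) :
    φ (T x) = φ x := LinearMap.congr_fun hφ.2 x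

theorem IsNormalPositive.mono {φ : A.Elem →ₗ[ℂ] ℂ} (hφ : IsNormalPositive φ) {x y : A.Elem}
    (h : x ≤ y) : φ x ≤ φ y := by
  rw [← sub_nonneg, ← map_sub]
  exact hφ.nonneg (sub_nonneg.2 h)

theorem corner_le_smul {y : A.Elem} (hy0 : 0 ≤ y) :
    (1 - maxPosRec T) * y * (1 - maxPosRec T) ≤ ‖y‖ • (1 - maxPosRec T) := by
  have hq : IsStarProjection (1 - maxPosRec T) := isStarProjection_maxPosRec.one_sub
  have h := CStarAlgebra.star_left_conjugate_le_norm_smul (a := 1 - maxPosRec T) (b := y)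
    (IsSelfAdjoint.of_nonneg hy0)
  rwa [hq.isSelfAdjoint.star_eq, hq.isIdempotentElem.eq] at h

namespace IsErgodicProjection

variable (hT : IsSchwarzMap T) (hP : IsErgodicProjection T P) (hp : P (maxPosRec T) = 1)

include hT hP hp

/-- If `P (p_R) = 1` then the powers of `T` converge to `0` on `1 - p_R`. -/
theorem tendsto_pow_one_sub {φ : A.Elem →ₗ[ℂ] ℂ} (hφ : IsNormalState φ) :
    Tendsto (fun n => φ (((T : Module.End ℂ A.Elem) ^ n) (1 - maxPosRec T))) atTop (𝓝 0) := by
  have hφn := (isNormalState_iff.1 hφ).1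
  have hq : IsStarProjection (1 - maxPosRec T) := isStarProjection_maxPosRec.one_sub
  have hle : maxPosRec T ≤ T (maxPosRec T) := hT.maxPosRec_le stationary_apply
  obtain ⟨U, hU, h⟩ := hP.exists_ultrafilter
  have h1 := h (maxPosRec T) φ hφ
  rw [hp] at h1
  rw [Metric.tendsto_atTop]
  intro ε hε
  obtain ⟨S, hS, hSε⟩ := (hU.and (Metric.tendsto_nhds.1 h1 ε hε)).exists
  obtain ⟨N, hN⟩ := hT.exists_le_pow_apply hle hS
  refine ⟨N, fun n hn => ?_⟩
  have h2 : S (maxPosRec T) ≤ ((T : Module.End ℂ A.Elem) ^ n) (maxPosRec T) :=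
    hN.trans (hT.monotone_pow_apply hle hn)
  have h3 : ((T : Module.End ℂ A.Elem) ^ n) (1 - maxPosRec T) ≤ 1 - S (maxPosRec T) := by
    rw [map_sub, (hT.pow n).map_one]
    exact sub_le_sub_left h2 1
  have h4 : 0 ≤ ((T : Module.End ℂ A.Elem) ^ n) (1 - maxPosRec T) := (hT.pow n).nonneg hq.nonneg
  have h5 := CStarAlgebra.norm_le_norm_of_nonneg_of_le (hφn.nonneg h4) (hφn.mono h3)
  rw [dist_zero_right]
  refine h5.trans_lt ?_
  rwa [map_sub, ← norm_neg, neg_sub, ← dist_eq_norm]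

/-- Makes the sequence approximating `φ ∘ P` increase. Stationary states vanish on `T (q y q)`, `q =
1 - p_R`, so it lies in the corner of `q`; compressing `T (q y q) ≤ T y = y` by `q` gives the bound.
-/
theorem map_corner_le {y : A.Elem} (hy : y ∈ fixedSpace T) (hy0 : 0 ≤ y) :
    T ((1 - maxPosRec T) * y * (1 - maxPosRec T)) ≤
      (1 - maxPosRec T) * y * (1 - maxPosRec T) := by
  set p := maxPosRec T with hpdef
  have hpp : IsStarProjection p := isStarProjection_maxPosRec
  set r := (1 - p) * y * (1 - p) with hr
  have hr0 : 0 ≤ r := by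
    have := star_left_conjugate_nonneg hy0 (1 - p)
    rwa [hpp.one_sub.isSelfAdjoint.star_eq] at this
  have hTr0 : 0 ≤ T r := hT.nonneg hr0
  have hry : r ≤ y := by
    rw [← hP.compression_add hT hp hy, compression_apply]
    refine le_add_of_nonneg_left ?_
    have := star_left_conjugate_nonneg hy0 p
    rwa [hpp.isSelfAdjoint.star_eq] at this
  have hTry : T r ≤ y := (hT.mono hry).trans_eq hy
  have h1 : T r * p = 0 := mul_maxPosRec_eq_zero_of_nonneg hTr0 fun φ hφ => by
    have hφn := (isNormalState_iff.1 hφ.1).1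
    rw [stationary_apply φ hφ]
    refine le_antisymm ((hφn.mono (corner_le_smul hy0)).trans_eq ?_) (hφn.nonneg hr0)
    rw [← Complex.coe_smul, map_smul, map_sub, map_maxPosRec_stationary hφ, sub_self, smul_zero]
  have h2 : p * T r = 0 := by
    have h := congrArg star h1
    rwa [star_mul, star_zero, hpp.isSelfAdjoint.star_eq,
      (IsSelfAdjoint.of_nonneg hTr0).star_eq] at h
  have h3 : T r = star (1 - p) * T r * (1 - p) := by
    rw [hpp.one_sub.isSelfAdjoint.star_eq, mul_sub, sub_mul, one_mul, mul_one, h2, sub_zero, h1,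
      sub_zero]
  rw [h3]
  refine (star_left_conjugate_le_conjugate hTry (1 - p)).trans_eq ?_
  rw [hpp.one_sub.isSelfAdjoint.star_eq]

/-- An ergodic projection with `P (p_R) = 1` is normal. -/
theorem isNormalMap (hTn : IsNormalMap T) : IsNormalMap P := by
  have hPS := hP.isSchwarzMap hT
  intro φ hφ
  have hφn := (isNormalState_iff.1 hφ).1
  refine isNormalState_iff.2 ⟨?_, by
    rw [LinearMap.comp_apply, hPS.map_one, (isNormalState_iff.1 hφ).2]⟩
  set p := maxPosRec T with hpdef
  have hpp : IsStarProjection p := isStarProjection_maxPosRec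
  have hpow : ∀ n, IsNormalState (φ ∘ₗ ((T : Module.End ℂ A.Elem) ^ n)) := fun n => by
    induction n with
    | zero => exact hφ
    | succ n ih => exact hTn _ ih
  -- Since `T^n (P x) = P x` and fixed points are block diagonal, `ψ n` differs from `φ ∘ P` by `φ
  -- (T^n (q P(x) q))`, `q = 1 - p`. For `x ≥ 0` this is at most `‖P x‖ φ (T^n q)`, which tends to
  -- `0`.
  let ψ : ℕ → A.Elem →ₗ[ℂ] ℂ := fun n =>
    (φ ∘ₗ ((T : Module.End ℂ A.Elem) ^ n)) ∘ₗ compression p ∘ₗ P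
  have hψ : ∀ n, IsNormalPositive (ψ n) := fun n =>
    hPS.isNormalPositive_comp_compression (fun φ hφ => hP.apply_stationary hφ)
      (isNormalState_iff.1 (hpow n)).1
  have hψr : ∀ n x, ψ n x = φ (P x) -
      φ (((T : Module.End ℂ A.Elem) ^ n) ((1 - p) * P x * (1 - p))) := fun n x => by
    rw [← map_sub]
    nth_rw 1 [← pow_apply_of_fixed (T := T) (hP.apply_mem x) n]
    rw [← map_sub]
    nth_rw 1 [← hP.compression_add hT hp (hP.apply_mem x)]
    rw [add_sub_cancel_right]
    rfl
  have hr0 : ∀ x, 0 ≤ x → 0 ≤ (1 - p) * P x * (1 - p) := fun x hx => by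
    have := star_left_conjugate_nonneg (hPS.nonneg hx) (1 - p)
    rwa [hpp.one_sub.isSelfAdjoint.star_eq] at this
  have hmono : ∀ n x, 0 ≤ x → ψ n x ≤ ψ (n + 1) x := fun n x hx => by
    rw [hψr, hψr, pow_succ, Module.End.mul_apply]
    exact sub_le_sub_left (hφn.mono ((hT.pow n).mono
      (hP.map_corner_le hT hp (hP.apply_mem x) (hPS.nonneg hx)))) _
  have hlim : ∀ x, 0 ≤ x → Tendsto (fun n => ψ n x) atTop (𝓝 (φ (P x))) := fun x hx => by
    have h1 : Tendsto (fun n => φ (((T : Module.End ℂ A.Elem) ^ n) ((1 - p) * P x * (1 - p))))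
        atTop (𝓝 0) := by
      have h2 := (hP.tendsto_pow_one_sub hT hp hφ).norm.const_mul ‖P x‖
      rw [norm_zero, mul_zero] at h2
      refine squeeze_zero_norm (fun n => ?_) h2
      refine (CStarAlgebra.norm_le_norm_of_nonneg_of_le
        (hφn.nonneg ((hT.pow n).nonneg (hr0 x hx))) (hφn.mono ((hT.pow n).mono
          (corner_le_smul (hPS.nonneg hx))))).trans_eq ?_
      rw [← Complex.coe_smul, map_smul, map_smul, norm_smul, Complex.norm_of_nonneg (norm_nonneg _)]
    simpa only [hψr, sub_zero] using h1.const_sub (φ (P x))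
  -- Increments of `ψ`, with `ψ 0` as the zeroth term, so that the first `n + 1` of them sum to `ψ
  -- n`. Each is positive and dominated by a normal functional.
  let d : ℕ → A.Elem →ₗ[ℂ] ℂ := fun n => Nat.casesOn n (ψ 0) fun n => ψ (n + 1) - ψ n
  have hd0 : ∀ n x, 0 ≤ x → 0 ≤ d n x := fun n x hx => by
    cases n with
    | zero => exact (hψ 0).nonneg hx
    | succ n => exact sub_nonneg.2 (hmono n x hx)
  have hd : ∀ n, IsNormalPositive (d n) := fun n => by
    cases n with
    | zero => exact hψ 0
    | succ n =>
      exact (hψ (n + 1)).of_le (hd0 (n + 1)) fun x hx => sub_le_self _ ((hψ n).nonneg hx)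
  refine .hasSum_of_nonneg hd fun x hx => ?_
  have hsum : ∀ n, ∑ k ∈ Finset.range (n + 1), d k x = ψ n x := fun n => by
    rw [Finset.sum_range_succ']
    change ∑ k ∈ Finset.range n, (ψ (k + 1) x - ψ k x) + ψ 0 x = ψ n x
    rw [Finset.sum_range_sub (fun k => ψ k x), sub_add_cancel]
  have hre : ∀ n, d n x = ((d n x).re : ℂ) := fun n =>
    Complex.ext rfl (by simpa using (Complex.nonneg_iff.1 (hd0 n x hx)).2.symm)
  have hPre : φ (P x) = ((φ (P x)).re : ℂ) :=
    Complex.ext rfl (by simpa using (Complex.nonneg_iff.1 (hφn.nonneg (hPS.nonneg hx))).2.symm)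
  rw [LinearMap.comp_apply, hPre]
  rw [show (fun n => d n x) = fun n => ((d n x).re : ℂ) from funext hre, Complex.hasSum_ofReal,
    hasSum_iff_tendsto_nat_of_nonneg fun n => (Complex.nonneg_iff.1 (hd0 n x hx)).1, ← tendsto_add_atTop_iff_nat 1]
  refine ((Complex.continuous_re.tendsto _).comp (hlim x hx)).congr fun n => ?_
  rw [Function.comp, ← hsum, Complex.re_sum]

end IsErgodicProjection

/-! ### Conditions equivalent to `P p_R = 1`, and the main theorem -/

/-- A normal ergodic projection maps `p_R` to `1`. -/
theorem IsErgodicProjection.map_maxPosRec_of_isNormalMap (hT : IsSchwarzMap T)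
    (hP : IsErgodicProjection T P) (hn : IsNormalMap P) : P (maxPosRec T) = 1 := by
  refine elem_ext_normal fun φ hφ => ?_
  have hst : IsStationaryNormalState T (φ ∘ₗ P) :=
    ⟨hn φ hφ, by rw [LinearMap.comp_assoc, hP.comp_map]⟩
  have h := map_maxPosRec_stationary hst
  rwa [LinearMap.comp_apply, LinearMap.comp_apply, (hP.isSchwarzMap hT).map_one] at h

/-- Compressing `p_R ≤ P p_R ≤ 1` by `p_R` shows that the fixed points `P p_R` and `1` have the same
compression. -/
theorem IsErgodicProjection.map_maxPosRec_of_injOn (hT : IsSchwarzMap T)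
    (hP : IsErgodicProjection T P)
    (hinj : Set.InjOn (compression (maxPosRec T)) (fixedSpace T)) : P (maxPosRec T) = 1 := by
  have hpp : IsStarProjection (maxPosRec T) := isStarProjection_maxPosRec
  refine hinj (hP.apply_mem _) hT.map_one ?_
  have h1 : maxPosRec T ≤ P (maxPosRec T) :=
    (hP.isSchwarzMap hT).maxPosRec_le fun φ hφ => hP.apply_stationary hφ
  have h2 : P (maxPosRec T) ≤ 1 :=
    ((hP.isSchwarzMap hT).mono hpp.le_one).trans_eq (hP.isSchwarzMap hT).map_one
  rw [compression_apply, compression_apply]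
  refine le_antisymm ?_ ?_
  · have := star_left_conjugate_le_conjugate h2 (maxPosRec T)
    rwa [hpp.isSelfAdjoint.star_eq] at this
  · have := star_left_conjugate_le_conjugate h1 (maxPosRec T)
    rw [mul_one]
    rwa [hpp.isSelfAdjoint.star_eq, hpp.isIdempotentElem.eq] at this

theorem IsErgodicProjection.injOn_compression (hT : IsSchwarzMap T)
    (hP : IsErgodicProjection T P) (hp : P (maxPosRec T) = 1) :
    Set.InjOn (compression (maxPosRec T)) (fixedSpace T) := fun y hy z hz h => by
  rw [← hP.map_compression_of_mem hT hp hy, h, hP.map_compression_of_mem hT hp hz]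

/-- `p_R` is the unit of the corner and `1` that of the Choi–Effros product: if `P x = 1` then `1 =
P (p_R x) = P p_R ⋄ 1 = P p_R`. -/
theorem IsErgodicProjection.map_maxPosRec_of_isStarIsomorphism (hT : IsSchwarzMap T)
    (hP : IsErgodicProjection T P)
    (hJ : IsStarIsomorphism (recurrentFixedSpace T) (fixedSpace T) (choiEffrosMul P) P) :
    P (maxPosRec T) = 1 := by
  have hpp : IsStarProjection (maxPosRec T) := isStarProjection_maxPosRec
  have h1 : (1 : A.Elem) ∈ fixedSpace T := hT.map_one
  have hpB : maxPosRec T ∈ recurrentFixedSpace T :=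
    ⟨1, h1, by rw [compression_apply, mul_one, hpp.isIdempotentElem.eq]⟩
  obtain ⟨x, hx, hx1⟩ := hJ.bijOn.surjOn h1
  have hpx : maxPosRec T * x = x := by
    obtain ⟨y, -, rfl⟩ := hx
    rw [compression_apply, ← mul_assoc, ← mul_assoc, hpp.isIdempotentElem.eq]
  have h2 := hJ.map_mul _ hpB _ hx
  rw [hpx, hx1, choiEffrosMul, mul_one, hP.map_idem] at h2
  exact h2.symm

end VonNeumannAlgebra

end

open VonNeumannAlgebra
theorem mainTheorem9 {H : Type u} [NormedAddCommGroup H] [InnerProductSpace ℂ H] [CompleteSpace H]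
    (A : VonNeumannAlgebra H) (T : A.Elem →ₗ[ℂ] A.Elem) (hT : IsMarkovOperator T) :
    List.TFAE [
      IsWeakStarMeanErgodic T,
      ∃ P : A.Elem →ₗ[ℂ] A.Elem, IsErgodicProjection T P ∧ P (maxPosRec T) = 1,
      Set.InjOn (compression (maxPosRec T)) (fixedSpace T),
      ∃ P : A.Elem →ₗ[ℂ] A.Elem, IsErgodicProjection T P ∧
        IsStarIsomorphism (recurrentFixedSpace T) (fixedSpace T) (choiEffrosMul P) P] ∧
    ∀ P : A.Elem →ₗ[ℂ] A.Elem, IsErgodicProjection T P → IsNormalMap P →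
      (∀ P' : A.Elem →ₗ[ℂ] A.Elem, IsErgodicProjection T P' → P' = P) ∧
      IsStarIsomorphism (recurrentFixedSpace T) (fixedSpace T) (choiEffrosMul P) P ∧
      ∀ x ∈ recurrentFixedSpace T,
        P x = x + (1 - maxPosRec T) * P x * (1 - maxPosRec T) ∧
        ∀ y ∈ fixedSpace T, compression (maxPosRec T) y = x ↔ y = P x := by
  have hS := hT.isSchwarzMap
  constructor
  · tfae_have 1 → 2 := fun ⟨P, hP, hn⟩ => ⟨P, hP, hP.map_maxPosRec_of_isNormalMap hS hn⟩
    tfae_have 2 → 3 := fun ⟨P, hP, hp⟩ => hP.injOn_compression hS hp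
    tfae_have 3 → 2 := fun h => by
      obtain ⟨P, hP⟩ := exists_isErgodicProjection hT
      exact ⟨P, hP, hP.map_maxPosRec_of_injOn hS h⟩
    tfae_have 2 → 1 := fun ⟨P, hP, hp⟩ => ⟨P, hP, hP.isNormalMap hS hp hT.normal⟩
    tfae_have 2 → 4 := fun ⟨P, hP, hp⟩ => ⟨P, hP, hP.isStarIsomorphism hS hp⟩
    tfae_have 4 → 2 := fun ⟨P, hP, hJ⟩ => ⟨P, hP, hP.map_maxPosRec_of_isStarIsomorphism hS hJ⟩
    tfae_finish
  · intro P hP hn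
    have hp := hP.map_maxPosRec_of_isNormalMap hS hn
    refine ⟨fun P' hP' => hP.unique_of_isNormalMap hn hP', hP.isStarIsomorphism hS hp, ?_⟩
    rintro _ ⟨y, hy, rfl⟩
    rw [hP.map_compression_of_mem hS hp hy]
    exact ⟨(hP.compression_add hS hp hy).symm, fun z hz =>
      ⟨fun h => hP.injOn_compression hS hp hz hy h, fun h => by rw [h]⟩⟩
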